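/- **Setting.** For strings $x,y\in\Sigma^n$ over a finite alphabet let $\Delta(x,y)=|\{i: x_i\ne y_i\}|/n$. A string $x$ is $\varepsilon$-far from a property $\Pi\subseteq\Sigma^n$ if $\Delta(x,y)>\varepsilon$ for all $y\in\Pi$. An $\varepsilon$-tester for $\Pi$ is a probabilistic algorithm with query access to $x$ that outputs $1$ with probability at least $2/3$ if $x\in\Pi$, and outputs $0$ with probability at least $2/3$ if $x$ is $\varepsilon$-far from $\Pi$. $\Pi$ is $\varepsilon$-testable with $q$ queries if it has an $\varepsilon$-tester that is a probability distribution over decision trees making at most $q$ (adaptive) queries. A sample-based tester with sample complexity $s$ selects each coordinate independently with some probability $p$, where $pn\le s$, queries exactly the selected coordinates if there are at most $s$ of them (otherwise it queries nothing), and decides from what it has read and from internal randomness independent of the selection. **Theorem.** There is an absolute constant $C>0$ such that the following holds. Fix $\varepsilon>0$. Let $q(n)\ge 1$ and $k(n)\ge 0$ be sequences of integers and $\Sigma_n$ a sequence of finite alphabets (for instance, $q$ and $\Sigma$ fixed), such that, as $n\to\infty$, $q(n)^2\log^2(q(n)+1)=o(\log n)$ and, for all sufficiently large $n$, $$|\Sigma_n|\le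 n^{1/(C\,q(n)^3\log^3(q(n)+1))},\qquad k(n)\le \exp\!\left(n^{1/(C\,q(n)^2\log^2(q(n)+1))}\right).$$ (In particular, this covers $|\Sigma_n|=n^{1/\omega(q^3\log^3 (q+1))}$ and $k=\exp\left(n^{1/\omega(q^2\log^2 (q+1))}\right)$.) Then there is $s(n)=o(n)$ such that, for every $n$, every property $\Pi\subseteq\Sigma_n^n$ that is a union of $k(n)$ properties $\Pi_1,\dots,\Pi_{k(n)}\subseteq\Sigma_n^n$, each of them $\varepsilon/2$-testable with $q(n)$ adaptive queries, has a sample-based $\varepsilon$-tester with sample complexity $s(n)$. -/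

import Mathlib

open Filter Asymptotics

/-- The relative Hamming distance `|{i : x i ≠ y i}| / n` of two strings of length `n`. -/
noncomputable def relDist {n : ℕ} {α : Type*} (x y : Fin n → α) : ℝ :=
  open scoped Classical in (hammingDist x y : ℝ) / n

/-- `x` is `ε`-far from the property `P`: it is at relative distance more than `ε` from every
element of `P` (in particular, every string is `ε`-far from the empty property). -/
def IsFar {n : ℕ} {α : Type*} (ε : ℝ) (x : Fin n → α) (P : Set (Fin n → α)) : Prop :=
  ∀ y ∈ P, ε < relDist x y

/-- Decision trees over inputs in `α ^ n` with output in `Bool` that make at most `d` queries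
on every branch: a node queries a coordinate and branches according to the value read. -/
inductive DecisionTree (n : ℕ) (α : Type*) : ℕ → Type _
  | leaf {d : ℕ} (b : Bool) : DecisionTree n α d
  | query {d : ℕ} (i : Fin n) (next : α → DecisionTree n α d) : DecisionTree n α (d + 1)

/-- The output of a decision tree on input `x`. -/
def DecisionTree.eval {n : ℕ} {α : Type*} (x : Fin n → α) :
    {d : ℕ} → DecisionTree n α d → Bool
  | _, .leaf b => b
  | _, .query i next => (next (x i)).eval x

/-- A probabilistic algorithm making at most `q` adaptive queries: a probability distribution
over decision trees of depth at most `q`. -/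
abbrev QueryAlgorithm (n : ℕ) (α : Type*) (q : ℕ) := PMF (DecisionTree n α q)

/-- `Pr[T^x = b]`. -/
noncomputable def QueryAlgorithm.prOutput {n : ℕ} {α : Type*} {q : ℕ}
    (T : QueryAlgorithm n α q) (x : Fin n → α) (b : Bool) : ℝ :=
  (T.map (fun t => t.eval x) b).toReal

/-- An algorithm with output probabilities `pr x b = Pr[T^x = b]` is an `ε`-tester with error
rate `σ` for `P`: it accepts inputs in `P`, and rejects inputs that are `ε`-far from `P`, each
with probability at least `1 - σ`. -/
def IsTester {n : ℕ} {α : Type*} (ε σ : ℝ) (P : Set (Fin n → α))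
    (pr : (Fin n → α) → Bool → ℝ) : Prop :=
  (∀ x ∈ P, 1 - σ ≤ pr x true) ∧ (∀ x, IsFar ε x P → 1 - σ ≤ pr x false)

/-- `P` is `ε`-testable (with error rate `1/3`) with `q` adaptive queries. -/
def IsTestable {n : ℕ} {α : Type*} (ε : ℝ) (q : ℕ) (P : Set (Fin n → α)) : Prop :=
  ∃ T : QueryAlgorithm n α q, IsTester ε (1 / 3) P T.prOutput

/-- The deterministic part of a sample-based algorithm, once its internal randomness is fixed.
`decide Q a` is the output when the set `Q` of sampled coordinates was queried and the values `a`
were read; `overflow Q` is the output when `Q` exceeds the cap, in which case no coordinate is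
queried and the output cannot depend on the input string. -/
structure SampleRule (n : ℕ) (α : Type*) where
  decide : (Q : Finset (Fin n)) → (Q → α) → Bool
  overflow : Finset (Fin n) → Bool

/-- The output on input `x` when the sampled set is `Q` and the cap is `s`. -/
def SampleRule.output {n : ℕ} {α : Type*} (r : SampleRule n α) (s : ℕ)
    (x : Fin n → α) (Q : Finset (Fin n)) : Bool :=
  if Q.card ≤ s then r.decide Q (fun i => x i) else r.overflow Q

/-- A sample-based algorithm on `α ^ n` with sample complexity at most `s`: it selects every
coordinate independently with probability `p`, and queries the selected coordinates unless there
are more than `s` of them; both the cap and the expected number `p * n` of selected coordinates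
are at most `s`. Its internal randomness `rule`, a distribution over deterministic rules, is
independent of the selected set. -/
structure SampleAlgorithm (n : ℕ) (α : Type*) (s : ℕ) where
  p : ℝ
  p_nonneg : 0 ≤ p
  p_le_one : p ≤ 1
  expected_le : p * n ≤ s
  rule : PMF (SampleRule n α)

/-- `Pr[N^x = b]`, over the selected set and the internal randomness. -/
noncomputable def SampleAlgorithm.prOutput {n : ℕ} {α : Type*} {s : ℕ}
    (N : SampleAlgorithm n α s) (x : Fin n → α) (b : Bool) : ℝ :=
  ∑ Q : Finset (Fin n), N.p ^ Q.card * (1 - N.p) ^ (n - Q.card) *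
    (N.rule.map (fun r => r.output s x Q) b).toReal

/-- `P` has a sample-based `ε`-tester (with error rate `1/3`) of sample complexity at
most `s`. -/
def IsSampleTestable {n : ℕ} {α : Type*} (ε : ℝ) (s : ℕ) (P : Set (Fin n → α)) : Prop :=
  ∃ N : SampleAlgorithm n α s, IsTester ε (1 / 3) P N.prOutput

/-! Each tester is repeated until its error is at most `1 / (16 (r + 1))`, where `r` is the total
number of queries (`majority_error_le`), and is then simulated from a sample of rate `p`. Weighting
every accepting run whose queries were all sampled by the inverse of the probability of that event
gives an unbiased estimate of the acceptance probability. The estimate concentrates only if no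
coordinate is relevant to too many runs, so coordinates of high degree are put into a kernel whose
values are guessed instead of sampled. Degree counts all branches of the trees, so the kernel does
not depend on the input; this costs a factor `b ^ q` for an alphabet of size `b`.

The guesses must be paid for. With thresholds `G ^ l / n`, the kernel above level `l + 1` has at
most `H n / G ^ (l + 1)` elements, `H` bounding the reach of a run, whereas runs whose other queries
have degree at most `G ^ l / n` satisfy an upper tail bound `exp (-c n p ^ r / (r ^ 2 G ^ l))`. The
gap factor `G` between the two degrees makes the tail beat the number of guesses
(`sampleMean_exists_agree_le`). By pigeonhole, `r` queries miss one of `r + 1` gaps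
(`acceptWeight_le_sum_gapRuns`), so for an accepted input some level keeps a `1 / (r + 1)` share of
the acceptance probability. Conversely, the kernel has at most `ε n / 2` elements, so an input that
is `ε`-far from the union stays `ε / 2`-far from each property under every guess. The surplus in the
exponent absorbs the union bound over the `k` properties and the levels.

Both tail bounds rest on `sampleMean_captured_mul`, a size-biasing identity. The parameters are `p =
n ^ (-1 / (4 r ^ 2))` and `G = n ^ (1 / (2 r))`; the sample has size `o(n)` because `r ^ 2 = o(log
n)`. -/

/-- The expectation of `f Q` for a random set `Q` that contains every element of `Fin n`
independently with probability `p`. -/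
noncomputable def sampleMean {n : ℕ} (p : ℝ) (f : Finset (Fin n) → ℝ) : ℝ :=
  ∑ Q : Finset (Fin n), p ^ Q.card * (1 - p) ^ (n - Q.card) * f Q

/-! ### Expectations over a random set of coordinates. -/

section SampleMean

variable {n : ℕ} {p : ℝ}

lemma sampleMean_const (c : ℝ) : sampleMean (n := n) p (fun _ => c) = c := by
  have h := Fintype.sum_pow_mul_eq_add_pow (Fin n) p (1 - p)
  rw [Fintype.card_fin] at h
  rw [sampleMean, ← Finset.sum_mul, h]
  simp

lemma sampleMean_mono (h0 : 0 ≤ p) (h1 : p ≤ 1) {f g : Finset (Fin n) → ℝ}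
    (hfg : ∀ Q, f Q ≤ g Q) : sampleMean p f ≤ sampleMean p g := by
  have : 0 ≤ 1 - p := by linarith
  exact Finset.sum_le_sum fun Q _ => mul_le_mul_of_nonneg_left (hfg Q) (by positivity)

lemma sampleMean_nonneg (h0 : 0 ≤ p) (h1 : p ≤ 1) {f : Finset (Fin n) → ℝ}
    (hf : ∀ Q, 0 ≤ f Q) : 0 ≤ sampleMean p f :=
  (sampleMean_const (n := n) (p := p) 0).symm.le.trans (sampleMean_mono h0 h1 hf)

lemma sampleMean_add (f g : Finset (Fin n) → ℝ) :
    sampleMean p (fun Q => f Q + g Q) = sampleMean p f + sampleMean p g := by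
  simp only [sampleMean, mul_add, Finset.sum_add_distrib]

lemma sampleMean_sub (f g : Finset (Fin n) → ℝ) :
    sampleMean p (fun Q => f Q - g Q) = sampleMean p f - sampleMean p g := by
  simp only [sampleMean, mul_sub, Finset.sum_sub_distrib]

lemma sampleMean_const_mul (c : ℝ) (f : Finset (Fin n) → ℝ) :
    sampleMean p (fun Q => c * f Q) = c * sampleMean p f := by
  simp only [sampleMean, Finset.mul_sum]
  exact Finset.sum_congr rfl fun Q _ => by ring

lemma sampleMean_sum {ι : Type*} (s : Finset ι) (f : ι → Finset (Fin n) → ℝ) :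
    sampleMean p (fun Q => ∑ t ∈ s, f t Q) = ∑ t ∈ s, sampleMean p (f t) := by
  simp only [sampleMean, Finset.mul_sum]
  exact Finset.sum_comm

lemma sampleMean_ite_mem (i : Fin n) (f : Finset (Fin n) → ℝ) :
    sampleMean p (fun Q => if i ∈ Q then f Q else 0) =
      p * sampleMean p (fun Q => f (insert i Q)) := by
  have key : ∀ F : Finset (Fin n) → ℝ, ∑ Q, F Q =
      ∑ R ∈ (Finset.univ.erase i).powerset, (F R + F (insert i R)) := by
    intro F
    rw [← Finset.powerset_univ, ← Finset.insert_erase (Finset.mem_univ i),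
      Finset.sum_powerset_insert (Finset.notMem_erase i _), Finset.sum_add_distrib]
    simp
  unfold sampleMean
  rw [key, key, Finset.mul_sum]
  refine Finset.sum_congr rfl fun R hR => ?_
  have hi : i ∉ R := fun h => Finset.notMem_erase i _ (Finset.mem_powerset.1 hR h)
  -- This keeps `n - R.card` positive, so that a factor `1 - p` splits off and recombines with `p`
  -- to `1`.
  have hc : R.card + 1 ≤ n := by
    rw [← Finset.card_insert_of_notMem hi]
    simpa using Finset.card_le_univ (insert i R)
  obtain ⟨d, hd⟩ := Nat.exists_eq_add_of_le hc
  rw [Finset.card_insert_of_notMem hi, show n - R.card = d + 1 by omega,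
    show n - (R.card + 1) = d by omega]
  simp only [hi, if_false, Finset.mem_insert_self, if_true, Finset.insert_idem]
  ring

/-- By independence, conditioning on `S ⊆ Q` amounts to adding `S` to an unconditioned sample. -/
lemma sampleMean_ite_subset (S : Finset (Fin n)) (f : Finset (Fin n) → ℝ) :
    sampleMean p (fun Q => if S ⊆ Q then f Q else 0) =
      p ^ S.card * sampleMean p (fun Q => f (Q ∪ S)) := by
  induction S using Finset.induction_on generalizing f with
  | empty => simp
  | insert i S hi ih =>
    have h1 : ∀ Q : Finset (Fin n), (if insert i S ⊆ Q then f Q else 0) =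
        if S ⊆ Q then (if i ∈ Q then f Q else 0) else 0 := by
      intro Q
      have : insert i S ⊆ Q ↔ i ∈ Q ∧ S ⊆ Q := Finset.insert_subset_iff
      split_ifs <;> tauto
    have h2 : ∀ Q : Finset (Fin n), (if i ∈ Q ∪ S then f (Q ∪ S) else 0) =
        if i ∈ Q then f (Q ∪ S) else 0 := by
      intro Q
      simp [hi]
    simp only [h1]
    rw [ih]
    simp only [h2]
    rw [sampleMean_ite_mem, Finset.card_insert_of_notMem hi, pow_succ]
    simp only [Finset.insert_union, Finset.union_insert]
    ring

lemma sampleMean_card : sampleMean p (fun Q : Finset (Fin n) => (Q.card : ℝ)) = p * n := by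
  have h : ∀ Q : Finset (Fin n), (Q.card : ℝ) = ∑ i, if i ∈ Q then (1 : ℝ) else 0 := by
    intro Q
    simp
  simp only [h]
  rw [sampleMean_sum]
  simp only [sampleMean_ite_mem, sampleMean_const]
  simp [mul_comm]

/-- Markov's inequality for the size of the sample. -/
lemma sampleMean_card_gt_le (h0 : 0 ≤ p) (h1 : p ≤ 1) {s : ℕ} {δ : ℝ} (hδ : 0 ≤ δ)
    (hs : p * n ≤ δ * s) :
    sampleMean (n := n) p (fun Q => if s < Q.card then 1 else 0) ≤ δ := by
  have hmono : sampleMean (n := n) p (fun Q => (s : ℝ) * if s < Q.card then 1 else 0) ≤ p * n := by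
    rw [← sampleMean_card]
    refine sampleMean_mono h0 h1 fun Q => ?_
    split_ifs with h
    · simpa using h.le
    · simp
  rw [sampleMean_const_mul] at hmono
  rcases Nat.eq_zero_or_pos s with rfl | hpos
  · have hpn : p * n = 0 := le_antisymm (by simpa using hs) (by positivity)
    refine (sampleMean_mono (g := fun Q => (Q.card : ℝ)) h0 h1 fun Q => ?_).trans ?_
    · split_ifs with h
      · exact_mod_cast h
      · simp
    · rw [sampleMean_card, hpn]
      exact hδ
  · have hp : (0 : ℝ) < s := by exact_mod_cast hpos
    nlinarith

/-! ### Concentration of the captured weight. -/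

/-- The part of the total weight `c` carried by the sets `S t` that are contained in `Q`. -/
def captured {ι : Type*} (I : Finset ι) (c : ι → ℝ) (S : ι → Finset (Fin n))
    (Q : Finset (Fin n)) : ℝ :=
  ∑ t ∈ I, if S t ⊆ Q then c t else 0

variable {ι : Type*} {I : Finset ι} {c : ι → ℝ} {S : ι → Finset (Fin n)} {r : ℕ} {B : ℝ}

lemma captured_nonneg (hc : ∀ t ∈ I, 0 ≤ c t) (Q : Finset (Fin n)) : 0 ≤ captured I c S Q :=
  Finset.sum_nonneg fun t ht => by
    split_ifs
    · exact hc t ht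
    · exact le_rfl

/-- Size-biasing: a factor `captured` is traded for forcing one of the sets into the sample. Taking
`f` to be `captured` itself or its exponential gives the two tail bounds. -/
lemma sampleMean_captured_mul (f : Finset (Fin n) → ℝ) :
    sampleMean p (fun Q => captured I c S Q * f Q) =
      ∑ t ∈ I, c t * p ^ (S t).card * sampleMean p (fun Q => f (Q ∪ S t)) := by
  simp only [captured, Finset.sum_mul]
  rw [sampleMean_sum]
  refine Finset.sum_congr rfl fun t _ => ?_
  rw [mul_assoc, ← sampleMean_ite_subset, ← sampleMean_const_mul]
  congr 1
  funext Q
  split_ifs <;> simp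

lemma sampleMean_captured :
    sampleMean p (captured I c S) = ∑ t ∈ I, c t * p ^ (S t).card := by
  simpa [sampleMean_const] using
    sampleMean_captured_mul (p := p) (I := I) (c := c) (S := S) (fun _ => 1)

/-- A newly captured set contains a point of `R` outside `Q`, and can be charged to that point. -/
lemma captured_union_le (hc : ∀ t ∈ I, 0 ≤ c t) (hB0 : 0 ≤ B)
    (hB : ∀ i, ∑ t ∈ I, (if i ∈ S t then c t else 0) ≤ B)
    {R : Finset (Fin n)} (hR : R.card ≤ r) (Q : Finset (Fin n)) :
    captured I c S (Q ∪ R) ≤ captured I c S Q + r * B := by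
  have h1 : captured I c S (Q ∪ R) ≤
      captured I c S Q + ∑ i ∈ R, ∑ t ∈ I, (if i ∈ S t then c t else 0) := by
    rw [Finset.sum_comm, captured, captured, ← Finset.sum_add_distrib]
    refine Finset.sum_le_sum fun t ht => ?_
    have hnn : ∀ i ∈ R, 0 ≤ if i ∈ S t then c t else 0 := fun i _ => by
      split_ifs
      · exact hc t ht
      · exact le_rfl
    by_cases hQ : S t ⊆ Q
    · rw [if_pos hQ, if_pos (hQ.trans Finset.subset_union_left)]
      linarith [Finset.sum_nonneg hnn]
    · rw [if_neg hQ, zero_add]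
      split_ifs with hQR
      · obtain ⟨i, hiS, hiQ⟩ := Finset.not_subset.1 hQ
        have hiR : i ∈ R := (Finset.mem_union.1 (hQR hiS)).resolve_left hiQ
        have := Finset.single_le_sum hnn hiR
        rwa [if_pos hiS] at this
      · exact Finset.sum_nonneg hnn
  have h2 : ∑ i ∈ R, ∑ t ∈ I, (if i ∈ S t then c t else 0) ≤ R.card * B := by
    refine (Finset.sum_le_sum fun i _ => hB i).trans ?_
    simp
  have h3 : (R.card : ℝ) * B ≤ r * B := mul_le_mul_of_nonneg_right (by exact_mod_cast hR) hB0
  linarith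

/-- Upper tail of the captured weight. -/
lemma sampleMean_captured_upper (h0 : 0 ≤ p) (h1 : p ≤ 1) (hc : ∀ t ∈ I, 0 ≤ c t)
    (hB0 : 0 ≤ B) (hB : ∀ i, ∑ t ∈ I, (if i ∈ S t then c t else 0) ≤ B)
    (hS : ∀ t ∈ I, (S t).card ≤ r) {θ l : ℝ} (hθ : 0 < θ)
    (hμ : sampleMean p (captured I c S) ≤ θ) (hl : 0 ≤ l) (hlB : l * (r * B) ≤ Real.log 2) :
    sampleMean p (fun Q => if 4 * θ ≤ captured I c S Q then 1 else 0) ≤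
      Real.exp (-(2 * l * θ)) := by
  set Z := captured I c S with hZ
  have hZ0 : ∀ Q, 0 ≤ Z Q := captured_nonneg hc
  set M := sampleMean p (fun Q => Real.exp (l * Z Q)) with hM
  have hM0 : 0 ≤ M := sampleMean_nonneg h0 h1 fun Q => (Real.exp_pos _).le
  -- Forcing `S t` into the sample raises `Z` by at most `r * B`, hence `exp (l * Z)` by a factor of
  -- at most `2`.
  have hstep : sampleMean p (fun Q => Z Q * Real.exp (l * Z Q)) ≤ 2 * θ * M := by
    rw [hZ, sampleMean_captured_mul]
    have : ∀ t ∈ I, c t * p ^ (S t).card *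
        sampleMean p (fun Q => Real.exp (l * captured I c S (Q ∪ S t))) ≤
        c t * p ^ (S t).card * (2 * M) := by
      intro t ht
      have hct := hc t ht
      refine mul_le_mul_of_nonneg_left ?_ (by positivity)
      rw [hM, ← sampleMean_const_mul]
      refine sampleMean_mono h0 h1 fun Q => ?_
      have hu := captured_union_le hc hB0 hB (hS t ht) Q
      calc Real.exp (l * captured I c S (Q ∪ S t))
          ≤ Real.exp (Real.log 2 + l * Z Q) := by
            refine Real.exp_le_exp.2 ?_
            have := mul_le_mul_of_nonneg_left hu hl
            rw [mul_add] at this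
            linarith
        _ = 2 * Real.exp (l * Z Q) := by
            rw [Real.exp_add, Real.exp_log two_pos]
    refine (Finset.sum_le_sum this).trans ?_
    rw [← Finset.sum_mul, ← sampleMean_captured]
    nlinarith
  -- The bracket is `(Z - 2θ) exp (l Z)`, whose mean is at most `0` by `hstep`; thus the unknown
  -- moment `M` drops out. It is at least `-2θ exp (2lθ)` everywhere.
  have hpt : ∀ Q, 2 * θ * Real.exp (4 * l * θ) * (if 4 * θ ≤ Z Q then 1 else 0) ≤
      (Z Q * Real.exp (l * Z Q) - 2 * θ * Real.exp (l * Z Q)) +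
        2 * θ * Real.exp (2 * l * θ) := by
    intro Q
    have hp1 := Real.exp_pos (2 * l * θ)
    have hp2 := Real.exp_pos (l * Z Q)
    split_ifs with h
    · have he : Real.exp (4 * l * θ) ≤ Real.exp (l * Z Q) :=
        Real.exp_le_exp.2 (by nlinarith)
      nlinarith [mul_le_mul_of_nonneg_left he hθ.le,
        mul_le_mul_of_nonneg_right h hp2.le]
    · rcases le_total (2 * θ) (Z Q) with h2 | h2
      · nlinarith [mul_le_mul_of_nonneg_right h2 hp2.le]
      · have he : Real.exp (l * Z Q) ≤ Real.exp (2 * l * θ) :=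
          Real.exp_le_exp.2 (by nlinarith)
        nlinarith [mul_le_mul_of_nonneg_left he hθ.le, mul_nonneg (hZ0 Q) hp2.le]
  have := sampleMean_mono h0 h1 hpt
  rw [sampleMean_const_mul, sampleMean_add, sampleMean_sub, sampleMean_const_mul,
    sampleMean_const] at this
  have hfin : 2 * θ * Real.exp (4 * l * θ) *
      sampleMean p (fun Q => if 4 * θ ≤ Z Q then 1 else 0) ≤ 2 * θ * Real.exp (2 * l * θ) := by
    linarith
  have he : Real.exp (2 * l * θ) = Real.exp (4 * l * θ) * Real.exp (-(2 * l * θ)) := by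
    rw [← Real.exp_add]
    congr 1
    ring
  rw [he, ← mul_assoc] at hfin
  exact le_of_mul_le_mul_left hfin (by positivity)

/-- Lower tail of the captured weight, by Chebyshev's inequality. -/
lemma sampleMean_captured_lower (h0 : 0 ≤ p) (h1 : p ≤ 1) (hc : ∀ t ∈ I, 0 ≤ c t)
    (hB0 : 0 ≤ B) (hB : ∀ i, ∑ t ∈ I, (if i ∈ S t then c t else 0) ≤ B)
    (hS : ∀ t ∈ I, (S t).card ≤ r) {τ δ : ℝ} (hτ : 0 < τ)
    (hμ : 2 * τ ≤ sampleMean p (captured I c S)) (hδ : 2 * (r * B) ≤ δ * τ) :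
    sampleMean p (fun Q => if captured I c S Q < τ then 1 else 0) ≤ δ := by
  set Z := captured I c S with hZ
  set μ := sampleMean p Z with hμd
  -- Equivalently, the variance is at most `μ * (r * B)`.
  have hsq : sampleMean p (fun Q => Z Q * Z Q) ≤ μ * (μ + r * B) := by
    rw [hZ, sampleMean_captured_mul]
    have : ∀ t ∈ I, c t * p ^ (S t).card * sampleMean p (fun Q => captured I c S (Q ∪ S t)) ≤
        c t * p ^ (S t).card * (μ + r * B) := by
      intro t ht
      have hct := hc t ht
      refine mul_le_mul_of_nonneg_left ?_ (by positivity)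
      rw [hμd, ← sampleMean_const (n := n) (p := p) (r * B), ← sampleMean_add]
      exact sampleMean_mono h0 h1 fun Q => captured_union_le hc hB0 hB (hS t ht) Q
    refine (Finset.sum_le_sum this).trans ?_
    rw [← Finset.sum_mul, ← sampleMean_captured]
  have hpt : ∀ Q, (μ / 2) ^ 2 * (if Z Q < τ then 1 else 0) ≤
      (Z Q * Z Q - 2 * μ * Z Q) + μ ^ 2 := by
    intro Q
    split_ifs with h
    · nlinarith
    · nlinarith [sq_nonneg (Z Q - μ)]
  have := sampleMean_mono h0 h1 hpt
  rw [sampleMean_const_mul, sampleMean_add, sampleMean_sub, sampleMean_const_mul,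
    sampleMean_const, ← hμd] at this
  set P := sampleMean p (fun Q => if Z Q < τ then (1 : ℝ) else 0)
  have hμ0 : 0 < μ := by linarith
  have h3 : μ * (μ * P) ≤ μ * (4 * (r * B)) := by nlinarith
  have h4 : μ * P ≤ 4 * (r * B) := le_of_mul_le_mul_left h3 hμ0
  have hδ0 : 0 ≤ δ := by
    by_contra hneg
    have : 0 ≤ (r : ℝ) * B := by positivity
    nlinarith
  have h5 : μ * P ≤ μ * δ := by nlinarith
  exact le_of_mul_le_mul_left h5 hμ0

end SampleMean

/-! ### Coordinates read by decision trees. -/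

namespace DecisionTree

variable {n : ℕ} {α : Type*}

/-- The coordinates queried by a decision tree on input `x`. -/
def queried (x : Fin n → α) : {d : ℕ} → DecisionTree n α d → Finset (Fin n)
  | _, .leaf _ => ∅
  | _, .query i next => insert i ((next (x i)).queried x)

/-- The coordinates queried by a decision tree on some input. -/
def reach [Fintype α] : {d : ℕ} → DecisionTree n α d → Finset (Fin n)
  | _, .leaf _ => ∅
  | _, .query i next => insert i (Finset.univ.biUnion fun a => (next a).reach)

lemma card_queried_le (x : Fin n → α) {d : ℕ} (t : DecisionTree n α d) :
    (t.queried x).card ≤ d := by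
  induction t with
  | leaf b => simp [queried]
  | query i next ih => exact (Finset.card_insert_le _ _).trans (Nat.succ_le_succ (ih _))

lemma queried_subset_reach [Fintype α] (x : Fin n → α) {d : ℕ} (t : DecisionTree n α d) :
    t.queried x ⊆ t.reach := by
  induction t with
  | leaf b => simp [queried]
  | query i next ih =>
    exact Finset.insert_subset_insert i
      ((ih _).trans (Finset.subset_biUnion_of_mem (fun a => (next a).reach) (Finset.mem_univ _)))

/-- The assumption `1 ≤ b` matters for an empty alphabet, where the root is still counted. -/
lemma card_reach_le [Fintype α] {b : ℕ} (hb : 1 ≤ b) (hα : Fintype.card α ≤ b) {d : ℕ}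
    (t : DecisionTree n α d) : t.reach.card ≤ d * b ^ d := by
  induction t with
  | leaf b => simp [reach]
  | @query d i next ih =>
    have h1 : (Finset.univ.biUnion fun a => (next a).reach).card ≤ b * (d * b ^ d) :=
      (Finset.card_biUnion_le_card_mul _ _ _ fun a _ => ih a).trans
        (Nat.mul_le_mul_right _ hα)
    have h2 : 1 ≤ b ^ (d + 1) := Nat.one_le_pow _ _ hb
    calc (reach (query i next)).card
        ≤ (Finset.univ.biUnion fun a => (next a).reach).card + 1 := Finset.card_insert_le _ _
      _ ≤ b * (d * b ^ d) + b ^ (d + 1) := Nat.add_le_add h1 h2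
      _ = (d + 1) * b ^ (d + 1) := by ring

/-- Equal answers lead into the same subtree, so agreement along the path of `x` makes `y` follow
that path. -/
lemma local_of_agree {x y : Fin n → α} {d : ℕ} (t : DecisionTree n α d)
    (h : ∀ i ∈ t.queried x, x i = y i) :
    t.queried y = t.queried x ∧ t.eval y = t.eval x := by
  induction t with
  | leaf b => exact ⟨rfl, rfl⟩
  | query i next ih =>
    have hi : x i = y i := h i (Finset.mem_insert_self _ _)
    have := ih (x i) fun j hj => h j (Finset.mem_insert_of_mem hj)
    simp only [queried, eval, ← hi]
    rw [this.1, this.2]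
    exact ⟨rfl, rfl⟩

/-- This turns all probabilities over trees into finite sums. -/
instance finite [Finite α] (d : ℕ) : Finite (DecisionTree n α d) := by
  induction d with
  | zero =>
    refine Finite.of_surjective (fun b : Bool => (leaf b : DecisionTree n α 0)) ?_
    intro t
    cases t with
    | leaf b => exact ⟨b, rfl⟩
  | succ d ih =>
    refine Finite.of_surjective
      (fun u : Bool ⊕ (Fin n × (α → DecisionTree n α d)) =>
        (Sum.elim leaf (fun v => query v.1 v.2) u : DecisionTree n α (d + 1))) ?_
    intro t
    cases t with
    | leaf b => exact ⟨Sum.inl b, rfl⟩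
    | query i next => exact ⟨Sum.inr (i, next), rfl⟩

end DecisionTree

/-! ### Error reduction by majority vote. -/

lemma PMF.sum_toReal_eq_one {β : Type*} [Fintype β] (T : PMF β) : ∑ t, (T t).toReal = 1 := by
  rw [← ENNReal.toReal_sum fun t _ => T.apply_ne_top t, ← tsum_fintype (L := .unconditional β),
    T.tsum_coe, ENNReal.toReal_one]

lemma PMF.map_apply_toReal {β : Type*} [Fintype β] (T : PMF β) (f : β → Bool) (b : Bool) :
    (T.map f b).toReal = ∑ t, if f t = b then (T t).toReal else 0 := by
  classical
  rw [PMF.map_apply, tsum_fintype, ENNReal.toReal_sum]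
  · refine Finset.sum_congr rfl fun t _ => ?_
    by_cases h : f t = b
    · simp [h]
    · simp [h, Ne.symm h]
  · intro t _
    split_ifs
    · exact T.apply_ne_top t
    · simp

lemma QueryAlgorithm.prOutput_add {n : ℕ} {α : Type*} {q : ℕ} [Fintype (DecisionTree n α q)]
    (T : QueryAlgorithm n α q) (x : Fin n → α) : T.prOutput x true + T.prOutput x false = 1 := by
  rw [prOutput, prOutput, PMF.map_apply_toReal, PMF.map_apply_toReal,
    ← Finset.sum_add_distrib, ← T.sum_toReal_eq_one]
  refine Finset.sum_congr rfl fun t _ => ?_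
  cases t.eval x <;> simp

/-- In `2 * h` independent draws from a distribution that gives weight at most `1 / 3` to `D`, at
least half of the draws lie in `D` with probability at most `(8 / 9) ^ h`. -/
lemma sum_prod_majority_le {β : Type*} [Fintype β] (v : β → ℝ) (hv : ∀ t, 0 ≤ v t)
    (hv1 : ∑ t, v t = 1) (D : β → Prop) [DecidablePred D]
    (hD : ∑ t, (if D t then v t else 0) ≤ 1 / 3) (h : ℕ) :
    ∑ w : Fin (2 * h) → β,
      (if h ≤ (Finset.univ.filter fun i => D (w i)).card then ∏ i, v (w i) else 0) ≤
      (8 / 9 : ℝ) ^ h := by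
  -- Exponential Markov inequality: each draw in `D` earns a factor `2`, with mean at most `4 / 3`
  -- per draw, and `(4 / 3) ^ 2 / 2 = 8 / 9`.
  have hpt : ∀ w : Fin (2 * h) → β,
      (2 : ℝ) ^ h *
        (if h ≤ (Finset.univ.filter fun i => D (w i)).card then ∏ i, v (w i) else 0) ≤
      ∏ i, (v (w i) * if D (w i) then 2 else 1) := by
    intro w
    have hp : 0 ≤ ∏ i, v (w i) := Finset.prod_nonneg fun i _ => hv _
    rw [Finset.prod_mul_distrib, Finset.prod_ite, Finset.prod_const, Finset.prod_const_one, mul_one]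
    split_ifs with hc
    · rw [mul_comm]
      exact mul_le_mul_of_nonneg_left (pow_le_pow_right₀ one_le_two hc) hp
    · rw [mul_zero]
      positivity
  have hsum : ∑ t, (v t * if D t then 2 else 1) ≤ (4 / 3 : ℝ) := by
    have : ∀ t, (v t * if D t then (2 : ℝ) else 1) = v t + if D t then v t else 0 := by
      intro t
      split_ifs <;> ring
    simp only [this]
    rw [Finset.sum_add_distrib, hv1]
    linarith
  have hsum0 : 0 ≤ ∑ t, (v t * if D t then (2 : ℝ) else 1) :=
    Finset.sum_nonneg fun t _ => mul_nonneg (hv t) (by split_ifs <;> norm_num)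
  have hall := Finset.sum_le_sum fun w (_ : w ∈ Finset.univ) => hpt w
  rw [← Finset.mul_sum, ← Fintype.piFinset_univ,
    ← Finset.prod_univ_sum (fun _ => Finset.univ) (fun _ t => v t * if D t then (2 : ℝ) else 1),
    Finset.prod_const, Finset.card_univ, Fintype.card_fin] at hall
  rw [Fintype.piFinset_univ] at hall
  have h2 := hall.trans (pow_le_pow_left₀ hsum0 hsum (2 * h))
  have h3 : (4 / 3 : ℝ) ^ (2 * h) = 2 ^ h * (8 / 9) ^ h := by
    rw [pow_mul, ← mul_pow]
    norm_num
  rw [h3] at h2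
  exact le_of_mul_le_mul_left h2 (by positivity)

lemma sum_prod_eq_one {β : Type*} [Fintype β] (v : β → ℝ) (hv1 : ∑ t, v t = 1) (m : ℕ) :
    ∑ w : Fin m → β, ∏ i, v (w i) = 1 := by
  have := Finset.prod_univ_sum (fun _ : Fin m => (Finset.univ : Finset β)) (fun _ t => v t)
  rw [Fintype.piFinset_univ] at this
  rw [← this, Finset.prod_const, hv1, one_pow]

/-- A finite distribution over deterministic adaptive algorithms: `queried w x` is the set of
coordinates read on input `x`, and `reach w` contains the coordinates read on any input. -/
structure QueryScheme (n : ℕ) (α Ω : Type*) where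
  weight : Ω → ℝ
  queried : Ω → (Fin n → α) → Finset (Fin n)
  reach : Ω → Finset (Fin n)
  accepts : Ω → (Fin n → α) → Prop
  weight_nonneg : ∀ w, 0 ≤ weight w
  queried_subset : ∀ w x, queried w x ⊆ reach w
  local_of_agree : ∀ w x y, (∀ i ∈ queried w x, x i = y i) →
    queried w y = queried w x ∧ (accepts w y ↔ accepts w x)

namespace QueryScheme

variable {n : ℕ} {α Ω : Type*} [Fintype Ω]

open scoped Classical in
/-- The probability that the scheme accepts `x`. -/
noncomputable def acceptWeight (F : QueryScheme n α Ω) (x : Fin n → α) : ℝ :=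
  ∑ w, if F.accepts w x then F.weight w else 0

/-- The majority vote of `m` independent runs of a query algorithm. -/
noncomputable def majority [Fintype α] {q : ℕ} (T : QueryAlgorithm n α q) (m : ℕ) :
    QueryScheme n α (Fin m → DecisionTree n α q) where
  weight w := ∏ i, (T (w i)).toReal
  queried w x := Finset.univ.biUnion fun i => (w i).queried x
  reach w := Finset.univ.biUnion fun i => (w i).reach
  accepts w x := m ≤ 2 * (Finset.univ.filter fun i => (w i).eval x = true).card
  weight_nonneg w := Finset.prod_nonneg fun i _ => ENNReal.toReal_nonneg
  queried_subset w x := Finset.biUnion_mono fun i _ => (w i).queried_subset_reach x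
  local_of_agree w x y h := by
    have key : ∀ i, (w i).queried y = (w i).queried x ∧ (w i).eval y = (w i).eval x := fun i =>
      (w i).local_of_agree fun j hj => h j (Finset.mem_biUnion.2 ⟨i, Finset.mem_univ _, hj⟩)
    simp only [fun i => (key i).1, fun i => (key i).2, and_self]

variable [Fintype α] {q : ℕ} (T : QueryAlgorithm n α q)

lemma card_queried_majority_le (m : ℕ) (w : Fin m → DecisionTree n α q) (x : Fin n → α) :
    ((majority T m).queried w x).card ≤ m * q := by
  refine (Finset.card_biUnion_le_card_mul _ _ q fun i _ => (w i).card_queried_le x).trans ?_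
  simp

lemma card_reach_majority_le {b : ℕ} (hb : 1 ≤ b) (hα : Fintype.card α ≤ b) (m : ℕ)
    (w : Fin m → DecisionTree n α q) :
    ((majority T m).reach w).card ≤ m * q * b ^ q := by
  refine (Finset.card_biUnion_le_card_mul _ _ (q * b ^ q) fun i _ =>
    (w i).card_reach_le hb hα).trans ?_
  simp [mul_assoc]

variable [Fintype (DecisionTree n α q)]

lemma sum_weight_majority (m : ℕ) : ∑ w, (majority T m).weight w = 1 :=
  sum_prod_eq_one _ T.sum_toReal_eq_one m

/-- A tie accepts, and the majority bound already counts ties as errors. -/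
lemma acceptWeight_majority_le {x : Fin n → α} (hx : 1 - 1 / 3 ≤ T.prOutput x false) (h : ℕ) :
    (majority T (2 * h)).acceptWeight x ≤ (8 / 9 : ℝ) ^ h := by
  have h1 : ∑ t, (if t.eval x = true then (T t).toReal else 0) ≤ 1 / 3 := by
    rw [← PMF.map_apply_toReal T (fun t => t.eval x) true]
    have := T.prOutput_add x
    rw [QueryAlgorithm.prOutput] at this
    linarith
  refine le_trans (le_of_eq ?_) (sum_prod_majority_le _ (fun t => ENNReal.toReal_nonneg)
    T.sum_toReal_eq_one (fun t => t.eval x = true) h1 h)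
  refine Finset.sum_congr rfl fun w _ => ?_
  simp only [majority, Nat.mul_le_mul_left_iff two_pos]

lemma le_acceptWeight_majority {x : Fin n → α} (hx : 1 - 1 / 3 ≤ T.prOutput x true) (h : ℕ) :
    1 - (8 / 9 : ℝ) ^ h ≤ (majority T (2 * h)).acceptWeight x := by
  have h1 : ∑ t, (if t.eval x = false then (T t).toReal else 0) ≤ 1 / 3 := by
    rw [← PMF.map_apply_toReal T (fun t => t.eval x) false]
    have := T.prOutput_add x
    rw [add_comm, QueryAlgorithm.prOutput] at this
    linarith
  have h2 := sum_prod_majority_le _ (fun t => ENNReal.toReal_nonneg)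
    T.sum_toReal_eq_one (fun t => t.eval x = false) h1 h
  have h3 := sum_weight_majority T (2 * h)
  have h4 : ∑ w, (majority T (2 * h)).weight w ≤ (majority T (2 * h)).acceptWeight x +
      ∑ w : Fin (2 * h) → DecisionTree n α q,
        (if h ≤ (Finset.univ.filter fun i => (w i).eval x = false).card
          then ∏ i, (T (w i)).toReal else 0) := by
    rw [acceptWeight, ← Finset.sum_add_distrib]
    refine Finset.sum_le_sum fun w _ => ?_
    have hw := (majority T (2 * h)).weight_nonneg w
    by_cases hacc : (majority T (2 * h)).accepts w x
    · rw [if_pos hacc]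
      refine le_add_of_nonneg_right ?_
      split_ifs
      · exact hw
      · exact le_rfl
    · rw [if_neg hacc, zero_add, if_pos]
      · exact le_rfl
      · have hc := Finset.card_filter_add_card_filter_not (s := Finset.univ)
          (fun i : Fin (2 * h) => (w i).eval x = true)
        simp only [Bool.not_eq_true, Finset.card_univ, Fintype.card_fin] at hc
        have : ¬ 2 * h ≤ 2 * (Finset.univ.filter fun i => (w i).eval x = true).card := hacc
        omega
  linarith

end QueryScheme

/-! ### Degrees, kernels and the estimate of the acceptance probability. -/

namespace QueryScheme

variable {n : ℕ} {α Ω : Type*} [Fintype Ω] (F : QueryScheme n α Ω)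

/-- The probability that coordinate `i` is within reach of the scheme. -/
noncomputable def degree (i : Fin n) : ℝ :=
  ∑ w, if i ∈ F.reach w then F.weight w else 0

open scoped Classical in
/-- The coordinates of degree more than `hi`. -/
noncomputable def kernel (hi : ℝ) : Finset (Fin n) :=
  Finset.univ.filter fun i => hi < F.degree i

open scoped Classical in
/-- The accepting runs on input `x` that query no coordinate of degree in `(lo, hi]`. -/
noncomputable def gapRuns (lo hi : ℝ) (x : Fin n → α) : Finset Ω :=
  Finset.univ.filter fun w =>
    F.accepts w x ∧ ∀ i ∈ F.queried w x, F.degree i ≤ lo ∨ hi < F.degree i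

/-- The estimate for the weight of `gapRuns` that can be computed from the coordinates in `Q` and
in the kernel: every run is weighted by the inverse of its probability to be seen. -/
noncomputable def estimate (p lo hi : ℝ) (x : Fin n → α) (Q : Finset (Fin n)) : ℝ :=
  captured (F.gapRuns lo hi x)
    (fun w => F.weight w / p ^ (F.queried w x \ F.kernel hi).card)
    (fun w => F.queried w x \ F.kernel hi) Q

variable {F} {p lo hi : ℝ} {r H : ℕ}

lemma mem_kernel {i : Fin n} : i ∈ F.kernel hi ↔ hi < F.degree i := by
  simp [kernel]

lemma mem_gapRuns {x : Fin n → α} {w : Ω} : w ∈ F.gapRuns lo hi x ↔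
    F.accepts w x ∧ ∀ i ∈ F.queried w x, F.degree i ≤ lo ∨ hi < F.degree i := by
  simp [gapRuns]

lemma sampleMean_estimate (hp : 0 < p) (x : Fin n → α) :
    sampleMean p (F.estimate p lo hi x) = ∑ w ∈ F.gapRuns lo hi x, F.weight w := by
  unfold estimate
  rw [sampleMean_captured]
  refine Finset.sum_congr rfl fun w _ => ?_
  have := pow_pos hp (F.queried w x \ F.kernel hi).card
  field_simp

lemma sum_gapRuns_le (x : Fin n → α) :
    ∑ w ∈ F.gapRuns lo hi x, F.weight w ≤ F.acceptWeight x := by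
  classical
  rw [acceptWeight, ← Finset.sum_filter]
  refine Finset.sum_le_sum_of_subset_of_nonneg (fun w hw => ?_) fun w _ _ => F.weight_nonneg w
  simp [(mem_gapRuns.1 hw).1]

lemma estimate_coeff_nonneg (hp : 0 < p) (x : Fin n → α) : ∀ w ∈ F.gapRuns lo hi x,
    0 ≤ F.weight w / p ^ (F.queried w x \ F.kernel hi).card := fun w _ => by
  have := F.weight_nonneg w
  positivity

/-- This supplies the bound `B` for the tail estimates: a gap run reads outside the kernel only
coordinates of degree at most `lo`, and inverse weighting costs at most `1 / p ^ r`. -/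
lemma estimate_coeff_degree_le (hp : 0 < p) (hp1 : p ≤ 1) (hlo : 0 ≤ lo)
    (hr : ∀ w x, (F.queried w x).card ≤ r) (x : Fin n → α) (i : Fin n) :
    ∑ w ∈ F.gapRuns lo hi x, (if i ∈ F.queried w x \ F.kernel hi then
      F.weight w / p ^ (F.queried w x \ F.kernel hi).card else 0) ≤ lo / p ^ r := by
  have hpr : 0 < p ^ r := pow_pos hp r
  by_cases hex : ∃ w ∈ F.gapRuns lo hi x, i ∈ F.queried w x \ F.kernel hi
  · obtain ⟨w, hw, hi'⟩ := hex
    rw [Finset.mem_sdiff, mem_kernel] at hi'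
    have hdeg : F.degree i ≤ lo := ((mem_gapRuns.1 hw).2 i hi'.1).resolve_right hi'.2
    refine le_trans ?_ (div_le_div_of_nonneg_right hdeg hpr.le)
    rw [degree, Finset.sum_div]
    have hstep : ∀ w, (if i ∈ F.queried w x \ F.kernel hi then
        F.weight w / p ^ (F.queried w x \ F.kernel hi).card else 0) ≤
        (if i ∈ F.reach w then F.weight w else 0) / p ^ r := by
      intro w
      have hw0 := F.weight_nonneg w
      split_ifs with h1 h2 h2
      · refine div_le_div_of_nonneg_left hw0 hpr (pow_le_pow_of_le_one hp.le hp1 ?_)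
        exact (Finset.card_le_card Finset.sdiff_subset).trans (hr w x)
      · exact absurd (F.queried_subset w x (Finset.mem_sdiff.1 h1).1) h2
      · positivity
      · simp
    refine (Finset.sum_le_sum fun w _ => hstep w).trans
      (Finset.sum_le_sum_of_subset_of_nonneg (Finset.subset_univ _) fun w _ _ => ?_)
    have hw0 := F.weight_nonneg w
    split_ifs <;> positivity
  · push Not at hex
    rw [Finset.sum_eq_zero fun w hw => if_neg (hex w hw)]
    positivity

/-- The estimate depends only on the kernel and on the sampled coordinates. -/
lemma estimate_le_of_agree (hp : 0 < p) {y z : Fin n → α} {Q : Finset (Fin n)}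
    (hyz : ∀ i, i ∈ F.kernel hi ∨ i ∈ Q → y i = z i) :
    F.estimate p lo hi y Q ≤ F.estimate p lo hi z Q := by
  unfold estimate captured
  rw [← Finset.sum_filter, ← Finset.sum_filter]
  -- A run visible on `y` reads only coordinates where `y` and `z` agree, so it is equally visible
  -- on `z`.
  have key : ∀ w, F.queried w y \ F.kernel hi ⊆ Q →
      F.queried w z = F.queried w y ∧ (F.accepts w z ↔ F.accepts w y) := by
    intro w hw
    refine F.local_of_agree w y z fun i hi' => hyz i ?_
    by_cases hk : i ∈ F.kernel hi
    · exact Or.inl hk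
    · exact Or.inr (hw (Finset.mem_sdiff.2 ⟨hi', hk⟩))
  calc _ = ∑ w ∈ (F.gapRuns lo hi y).filter (fun w => F.queried w y \ F.kernel hi ⊆ Q),
        F.weight w / p ^ (F.queried w z \ F.kernel hi).card := by
        refine Finset.sum_congr rfl fun w hw => ?_
        rw [(key w (Finset.mem_filter.1 hw).2).1]
    _ ≤ _ := by
        refine Finset.sum_le_sum_of_subset_of_nonneg (fun w hw => ?_) fun w _ _ => ?_
        · rw [Finset.mem_filter, mem_gapRuns] at hw ⊢
          have hk := key w hw.2
          refine ⟨by rw [hk.1, hk.2]; exact hw.1, ?_⟩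
          show F.queried w z \ F.kernel hi ⊆ Q
          rw [hk.1]
          exact hw.2
        · have := F.weight_nonneg w
          positivity

/-- Double counting: the degrees sum to the expected size of the reach. -/
lemma card_kernel_mul_le (hF : ∑ w, F.weight w = 1) (hH : ∀ w, (F.reach w).card ≤ H) :
    ((F.kernel hi).card : ℝ) * hi ≤ H := by
  calc ((F.kernel hi).card : ℝ) * hi = ∑ i ∈ F.kernel hi, hi := by simp
    _ ≤ ∑ i ∈ F.kernel hi, F.degree i :=
        Finset.sum_le_sum fun i h => (mem_kernel.1 h).le
    _ ≤ ∑ i, F.degree i := by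
        refine Finset.sum_le_sum_of_subset_of_nonneg (Finset.subset_univ _) fun i _ _ => ?_
        refine Finset.sum_nonneg fun w _ => ?_
        have := F.weight_nonneg w
        split_ifs <;> positivity
    _ = ∑ w, ((F.reach w).card : ℝ) * F.weight w := by
        simp only [degree]
        rw [Finset.sum_comm]
        refine Finset.sum_congr rfl fun w _ => ?_
        rw [← Finset.sum_filter]
        simp
    _ ≤ ∑ w, (H : ℝ) * F.weight w :=
        Finset.sum_le_sum fun w _ =>
          mul_le_mul_of_nonneg_right (by exact_mod_cast hH w) (F.weight_nonneg w)
    _ = H := by rw [← Finset.mul_sum, hF, mul_one]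

/-- A set of at most `r` coordinates leaves one of `r + 1` consecutive ranges of degrees free. -/
lemma acceptWeight_le_sum_gapRuns {L : ℕ → ℝ} (hL : Monotone L)
    (hr : ∀ w x, (F.queried w x).card ≤ r) (x : Fin n → α) :
    F.acceptWeight x ≤
      ∑ l ∈ Finset.range (r + 1), ∑ w ∈ F.gapRuns (L l) (L (l + 1)) x, F.weight w := by
  classical
  have hgap : ∀ w, F.accepts w x → ∃ l ∈ Finset.range (r + 1), w ∈ F.gapRuns (L l) (L (l + 1)) x := by
    intro w hw
    by_contra hcon
    simp only [mem_gapRuns, hw, true_and] at hcon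
    push Not at hcon
    -- `choose!` needs a default coordinate. The chosen coordinates have degrees in disjoint ranges,
    -- so they would be `r + 1` distinct queries.
    obtain ⟨i₀, -⟩ := hcon 0 (by simp)
    have : Nonempty (Fin n) := ⟨i₀⟩
    choose! f hf1 hf2 using hcon
    have hinj : Set.InjOn f (Finset.range (r + 1) : Set ℕ) := by
      intro a ha b hb hab
      by_contra hne
      rcases lt_or_gt_of_ne hne with h | h
      · have h1 := (hf2 a ha).2
        have h2 := (hf2 b hb).1
        rw [hab] at h1
        linarith [hL (Nat.succ_le_of_lt h)]
      · have h1 := (hf2 b hb).2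
        have h2 := (hf2 a ha).1
        rw [hab] at h2
        linarith [hL (Nat.succ_le_of_lt h)]
    have := Finset.card_le_card_of_injOn f (fun l hl => hf1 l hl) hinj
    rw [Finset.card_range] at this
    exact absurd (this.trans (hr w x)) (by omega)
  have hrw : ∀ l, ∑ w ∈ F.gapRuns (L l) (L (l + 1)) x, F.weight w =
      ∑ w, if w ∈ F.gapRuns (L l) (L (l + 1)) x then F.weight w else 0 := fun l => by
    rw [← Finset.sum_filter]
    simp
  simp only [hrw]
  rw [Finset.sum_comm, acceptWeight]
  refine Finset.sum_le_sum fun w _ => ?_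
  have hnn : ∀ l ∈ Finset.range (r + 1),
      0 ≤ if w ∈ F.gapRuns (L l) (L (l + 1)) x then F.weight w else 0 := fun l _ => by
    have := F.weight_nonneg w
    split_ifs <;> positivity
  split_ifs with hw
  · obtain ⟨l, hl, hmem⟩ := hgap w hw
    have := Finset.single_le_sum hnn hl
    rwa [if_pos hmem] at this
  · exact Finset.sum_nonneg hnn

end QueryScheme

/-! ### Kernel completions and the union bound. -/

lemma SampleAlgorithm.prOutput_of_pure {n s : ℕ} {α : Type*} (N : SampleAlgorithm n α s)
    (R : SampleRule n α) (hN : N.rule = PMF.pure R) (x : Fin n → α) (b : Bool) :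
    N.prOutput x b = sampleMean N.p fun Q => if R.output s x Q = b then 1 else 0 := by
  unfold SampleAlgorithm.prOutput sampleMean
  refine Finset.sum_congr rfl fun Q _ => ?_
  rw [hN, PMF.pure_map, PMF.pure_apply]
  by_cases h : R.output s x Q = b
  · simp [h]
  · simp [h, Ne.symm h]

lemma card_agree_le {n : ℕ} {α : Type*} [Fintype α] [DecidableEq α] (K : Finset (Fin n))
    (x : Fin n → α) :
    (Finset.univ.filter fun y : Fin n → α => ∀ i ∉ K, y i = x i).card ≤
      Fintype.card α ^ K.card := by
  have hc : Fintype.card α ^ K.card = (Finset.univ : Finset (K → α)).card := by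
    simp
  rw [hc]
  refine Finset.card_le_card_of_injOn (fun y i => y i) (fun _ _ => Finset.mem_univ _) ?_
  intro y hy z hz hyz
  simp only [Finset.coe_filter, Finset.mem_univ, true_and, Set.mem_ofPred_eq] at hy hz
  funext i
  by_cases hi : i ∈ K
  · exact congrFun hyz ⟨i, hi⟩
  · rw [hy i hi, hz i hi]

/-- Changing `x` on `K` costs relative distance at most `ε / 2`, so guessed kernel values cannot
bring a far input close. -/
lemma isFar_of_agree {n : ℕ} {α : Type*} {ε : ℝ} {x y : Fin n → α} {P : Set (Fin n → α)}
    {K : Finset (Fin n)} (hx : IsFar ε x P) (hy : ∀ i ∉ K, y i = x i)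
    (hK : (K.card : ℝ) ≤ ε / 2 * n) (hn : 0 < n) : IsFar (ε / 2) y P := by
  classical
  intro z hz
  have h1 := hx z hz
  have hn' : (0 : ℝ) < n := by exact_mod_cast hn
  unfold relDist at h1 ⊢
  rw [lt_div_iff₀ hn'] at h1 ⊢
  have h2 := hammingDist_triangle x y z
  have h3 : hammingDist x y ≤ K.card := by
    refine Finset.card_le_card fun i hi => ?_
    by_contra hk
    exact (Finset.mem_filter.1 hi).2 (hy i hk).symm
  have h4 : (hammingDist x z : ℝ) ≤ K.card + hammingDist y z := by
    exact_mod_cast h2.trans (Nat.add_le_add_right h3 _)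
  have h5 : ε * n < (hammingDist x z : ℝ) := by convert h1
  have h6 : ε / 2 * n < (hammingDist y z : ℝ) := by linarith
  convert h6

/-- The union bound. -/
lemma sampleMean_exists_le_sum {n : ℕ} {p : ℝ} (h0 : 0 ≤ p) (h1 : p ≤ 1) {ι : Type*}
    (s : Finset ι) (E : ι → Finset (Fin n) → Prop) [∀ t Q, Decidable (E t Q)]
    (D : Finset (Fin n) → Prop) [DecidablePred D] (hD : ∀ Q, D Q → ∃ t ∈ s, E t Q) :
    sampleMean p (fun Q => if D Q then 1 else 0) ≤
      ∑ t ∈ s, sampleMean p (fun Q => if E t Q then 1 else 0) := by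
  rw [← sampleMean_sum]
  refine sampleMean_mono h0 h1 fun Q => ?_
  have hnn : ∀ t ∈ s, (0 : ℝ) ≤ if E t Q then 1 else 0 := fun t _ => by
    split_ifs <;> norm_num
  split_ifs with hQ
  · obtain ⟨t, ht, hE⟩ := hD Q hQ
    have := Finset.single_le_sum hnn ht
    rwa [if_pos hE] at this
  · exact Finset.sum_nonneg hnn

/-! ### The threshold tester. -/

namespace QueryScheme

variable {n : ℕ} {α Ω : Type*} [Fintype Ω]

open scoped Classical in
/-- Accept if some completion of the sample outside of some kernel makes the estimate of some
scheme of the family reach the threshold `τ`. -/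
noncomputable def thresholdRule {k : ℕ} (F : Fin k → QueryScheme n α Ω) (L : ℕ → ℝ) (r : ℕ)
    (p τ : ℝ) : SampleRule n α where
  decide Q a := Decidable.decide (∃ j, ∃ l ∈ Finset.range (r + 1), ∃ y : Fin n → α,
    (∀ i (h : i ∈ Q), i ∉ (F j).kernel (L (l + 1)) → y i = a ⟨i, h⟩) ∧
      τ ≤ (F j).estimate p (L l) (L (l + 1)) y Q)
  overflow _ := false

variable {F : QueryScheme n α Ω} {r H : ℕ} {p G : ℝ}

lemma sampleMean_estimate_upper (hn : 0 < n) (hr0 : 0 < r) (hp : 0 < p) (hp1 : p ≤ 1)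
    (hG : 1 ≤ G) (hr : ∀ w x, (F.queried w x).card ≤ r) {y : Fin n → α}
    (hy : F.acceptWeight y ≤ 1 / (16 * ((r : ℝ) + 1))) (l : ℕ) (hi : ℝ) :
    sampleMean p (fun Q => if 1 / (4 * ((r : ℝ) + 1)) ≤ F.estimate p (G ^ l / n) hi y Q
      then 1 else 0) ≤
      Real.exp (-(Real.log 2 * (n * p ^ r) / (8 * r * (r + 1) * G ^ l))) := by
  have hn' : (0 : ℝ) < n := by exact_mod_cast hn
  have hr' : (0 : ℝ) < r := by exact_mod_cast hr0
  have hG0 : 0 < G := by linarith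
  have hpr : 0 < p ^ r := pow_pos hp r
  have hl2 : 0 < Real.log 2 := Real.log_pos one_lt_two
  have hB : 0 < G ^ l / n / p ^ r := by positivity
  have h := sampleMean_captured_upper (r := r) (θ := 1 / (16 * ((r : ℝ) + 1)))
    (l := Real.log 2 / (r * (G ^ l / n / p ^ r))) hp.le hp1
    (estimate_coeff_nonneg (F := F) (lo := G ^ l / n) (hi := hi) hp y) hB.le
    (estimate_coeff_degree_le hp hp1 (by positivity) hr y)
    (fun w _ => (Finset.card_le_card Finset.sdiff_subset).trans (hr w y))
    (by positivity) (((sampleMean_estimate hp y).le.trans (sum_gapRuns_le y)).trans hy)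
    (by positivity) (by rw [div_mul_cancel₀ _ (by positivity)])
  have e1 : 4 * (1 / (16 * ((r : ℝ) + 1))) = 1 / (4 * ((r : ℝ) + 1)) := by
    field_simp
    norm_num
  have e2 : 2 * (Real.log 2 / (r * (G ^ l / n / p ^ r))) * (1 / (16 * ((r : ℝ) + 1))) =
      Real.log 2 * (n * p ^ r) / (8 * r * (r + 1) * G ^ l) := by
    field_simp
    norm_num
  rw [e1, e2] at h
  exact h

/-- Completeness concerns only the true input, with no union bound, so Chebyshev is enough. -/
lemma sampleMean_estimate_lower (hn : 0 < n) (hp : 0 < p) (hp1 : p ≤ 1) (hG : 1 ≤ G)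
    (hr : ∀ w x, (F.queried w x).card ≤ r)
    (hsize : 80 * (r * (r + 1) * G ^ r) ≤ n * p ^ r) {x : Fin n → α} {l : ℕ} {hi : ℝ}
    (hl : l ≤ r)
    (hx : 1 / (2 * ((r : ℝ) + 1)) ≤ ∑ w ∈ F.gapRuns (G ^ l / n) hi x, F.weight w) :
    sampleMean p (fun Q => if F.estimate p (G ^ l / n) hi x Q < 1 / (4 * ((r : ℝ) + 1))
      then 1 else 0) ≤ 1 / 10 := by
  have hn' : (0 : ℝ) < n := by exact_mod_cast hn
  have hG0 : 0 < G := by linarith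
  have hpr : 0 < p ^ r := pow_pos hp r
  have hGl : G ^ l ≤ G ^ r := pow_le_pow_right₀ hG hl
  refine sampleMean_captured_lower (r := r) (τ := 1 / (4 * ((r : ℝ) + 1))) hp.le hp1
    (estimate_coeff_nonneg (F := F) (lo := G ^ l / n) (hi := hi) hp x) (by positivity)
    (estimate_coeff_degree_le hp hp1 (by positivity) hr x)
    (fun w _ => (Finset.card_le_card Finset.sdiff_subset).trans (hr w x))
    (by positivity) ?_ ?_
  · refine le_trans (le_of_eq ?_) (hx.trans (sampleMean_estimate hp x).ge)
    field_simp
    norm_num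
  · have e1 : 2 * ((r : ℝ) * (G ^ l / n / p ^ r)) = 2 * r * G ^ l / (n * p ^ r) := by
      field_simp
    rw [e1, div_le_iff₀ (by positivity)]
    have e2 : 1 / 10 * (1 / (4 * ((r : ℝ) + 1))) * (n * p ^ r) =
        n * p ^ r / (40 * (r + 1)) := by
      field_simp
      norm_num
    rw [e2, le_div_iff₀ (by positivity)]
    have : (r : ℝ) * (r + 1) * G ^ l ≤ r * (r + 1) * G ^ r :=
      mul_le_mul_of_nonneg_left hGl (by positivity)
    nlinarith

lemma sampleMean_exists_agree_le [Fintype α] (hn : 0 < n) (hr0 : 0 < r) (hp : 0 < p)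
    (hp1 : p ≤ 1) (hG : 1 ≤ G) (hF : ∑ w, F.weight w = 1)
    (hr : ∀ w x, (F.queried w x).card ≤ r) (hH : ∀ w, (F.reach w).card ≤ H)
    {b : ℕ} (hb : 1 ≤ b) (hα : Fintype.card α ≤ b)
    (hsize : 16 * (r * (r + 1) * (H * Real.log b)) ≤ Real.log 2 * (p ^ r * G))
    {x : Fin n → α} {l : ℕ} (hl : l ≤ r)
    (hx : ∀ y : Fin n → α, (∀ i ∉ F.kernel (G ^ (l + 1) / n), y i = x i) →
      F.acceptWeight y ≤ 1 / (16 * ((r : ℝ) + 1)))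
    (D : Finset (Fin n) → Prop) [DecidablePred D]
    (hD : ∀ Q, D Q → ∃ y : Fin n → α, (∀ i ∉ F.kernel (G ^ (l + 1) / n), y i = x i) ∧
      1 / (4 * ((r : ℝ) + 1)) ≤ F.estimate p (G ^ l / n) (G ^ (l + 1) / n) y Q) :
    sampleMean p (fun Q => if D Q then 1 else 0) ≤
      Real.exp (-(Real.log 2 * (n * p ^ r) / (16 * r * (r + 1) * G ^ r))) := by
  classical
  have hn' : (0 : ℝ) < n := by exact_mod_cast hn
  have hr' : (0 : ℝ) < r := by exact_mod_cast hr0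
  have hb' : (1 : ℝ) ≤ b := by exact_mod_cast hb
  have hG0 : 0 < G := by linarith
  have hpr : 0 < p ^ r := pow_pos hp r
  have hl2 : 0 < Real.log 2 := Real.log_pos one_lt_two
  have hlb : 0 ≤ Real.log b := Real.log_nonneg hb'
  have hGl : G ^ l ≤ G ^ r := pow_le_pow_right₀ hG hl
  set K := F.kernel (G ^ (l + 1) / n) with hK
  -- Half the exponent of the upper tail: there are at most `exp X` completions, each failing with
  -- probability at most `exp (-2X)`.
  set X := Real.log 2 * (n * p ^ r) / (16 * r * (r + 1) * G ^ l) with hX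
  have hcard : ((Finset.univ.filter fun y : Fin n → α => ∀ i ∉ K, y i = x i).card : ℝ) ≤
      Real.exp X := by
    have h1 : ((Finset.univ.filter fun y : Fin n → α => ∀ i ∉ K, y i = x i).card : ℝ) ≤
        (b : ℝ) ^ K.card := by
      exact_mod_cast (card_agree_le K x).trans (Nat.pow_le_pow_left hα _)
    have h2 : (b : ℝ) ^ K.card = Real.exp (K.card * Real.log b) := by
      rw [← Real.log_pow, Real.exp_log (by positivity)]
    rw [h2] at h1
    refine h1.trans (Real.exp_le_exp.2 ?_)
    have h3 : (K.card : ℝ) * (G ^ (l + 1) / n) ≤ H := card_kernel_mul_le hF hH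
    rw [hX, le_div_iff₀ (by positivity)]
    rw [mul_div_assoc', div_le_iff₀ hn'] at h3
    have h4 : (K.card : ℝ) * Real.log b * (16 * r * (r + 1) * G ^ l) * G ≤
        Real.log 2 * (n * p ^ r) * G := by
      calc (K.card : ℝ) * Real.log b * (16 * r * (r + 1) * G ^ l) * G
          = (K.card * G ^ (l + 1)) * (16 * r * (r + 1) * Real.log b) := by ring
        _ ≤ (H * n) * (16 * r * (r + 1) * Real.log b) :=
            mul_le_mul_of_nonneg_right h3 (by positivity)
        _ = n * (16 * (r * (r + 1) * (H * Real.log b))) := by ring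
        _ ≤ n * (Real.log 2 * (p ^ r * G)) := mul_le_mul_of_nonneg_left hsize hn'.le
        _ = _ := by ring
    exact le_of_mul_le_mul_right h4 hG0
  refine (sampleMean_exists_le_sum hp.le hp1
    (Finset.univ.filter fun y : Fin n → α => ∀ i ∉ K, y i = x i)
    (fun y Q => 1 / (4 * ((r : ℝ) + 1)) ≤ F.estimate p (G ^ l / n) (G ^ (l + 1) / n) y Q) D
    fun Q hQ => ?_).trans ?_
  · obtain ⟨y, hy1, hy2⟩ := hD Q hQ
    exact ⟨y, by simpa using hy1, hy2⟩
  · have hterm : ∀ y ∈ Finset.univ.filter fun y : Fin n → α => ∀ i ∉ K, y i = x i,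
        sampleMean p (fun Q => if 1 / (4 * ((r : ℝ) + 1)) ≤
          F.estimate p (G ^ l / n) (G ^ (l + 1) / n) y Q then 1 else 0) ≤
        Real.exp (-(X + X)) := by
      intro y hy
      refine (sampleMean_estimate_upper hn hr0 hp hp1 hG hr
        (hx y (by simpa using hy)) l _).trans (le_of_eq ?_)
      congr 2
      rw [hX]
      field_simp
      norm_num
    refine (Finset.sum_le_sum hterm).trans ?_
    rw [Finset.sum_const, nsmul_eq_mul]
    refine (mul_le_mul_of_nonneg_right hcard (Real.exp_pos _).le).trans ?_
    rw [← Real.exp_add]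
    refine Real.exp_le_exp.2 ?_
    have hXr : Real.log 2 * (n * p ^ r) / (16 * r * (r + 1) * G ^ r) ≤ X :=
      div_le_div_of_nonneg_left (by positivity) (by positivity)
        (mul_le_mul_of_nonneg_left hGl (by positivity))
    linarith

lemma thresholdRule_output_of_le {k s : ℕ} {F : Fin k → QueryScheme n α Ω} {L : ℕ → ℝ} {τ : ℝ}
    {x : Fin n → α} {Q : Finset (Fin n)} (hQ : Q.card ≤ s) (j : Fin k) {l : ℕ}
    (hl : l ∈ Finset.range (r + 1)) (h : τ ≤ (F j).estimate p (L l) (L (l + 1)) x Q) :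
    (thresholdRule F L r p τ).output s x Q = true := by
  classical
  rw [SampleRule.output, if_pos hQ]
  exact decide_eq_true ⟨j, l, hl, x, fun i _ _ => rfl, h⟩

/-- Outside the kernel and the sample the witness is irrelevant to the estimate, so it may be
replaced by `x` there. Only the kernel values remain to be enumerated. -/
lemma exists_of_thresholdRule_output {k s : ℕ} {F : Fin k → QueryScheme n α Ω} {L : ℕ → ℝ}
    {τ : ℝ} {x : Fin n → α} {Q : Finset (Fin n)} (hp : 0 < p)
    (h : (thresholdRule F L r p τ).output s x Q = true) :
    ∃ j, ∃ l ∈ Finset.range (r + 1), ∃ y : Fin n → α,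
      (∀ i ∉ (F j).kernel (L (l + 1)), y i = x i) ∧
        τ ≤ (F j).estimate p (L l) (L (l + 1)) y Q := by
  classical
  rw [SampleRule.output] at h
  split_ifs at h with hc
  · obtain ⟨j, l, hl, y, hy1, hy2⟩ := of_decide_eq_true h
    refine ⟨j, l, hl, fun i => if i ∈ (F j).kernel (L (l + 1)) then y i else x i,
      fun i hi => if_neg hi, hy2.trans (estimate_le_of_agree hp fun i hi => ?_)⟩
    by_cases hik : i ∈ (F j).kernel (L (l + 1))
    · rw [if_pos hik]
    · rw [if_neg hik]
      exact hy1 i (hi.resolve_left hik) hik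
  · exact absurd h Bool.false_ne_true

/-- Some level carries weight `1 / (2 (r + 1))`, twice the threshold. The failure probability is at
most `1 / 10` from Chebyshev plus `1 / 100` from overflow. -/
lemma thresholdRule_complete {k s : ℕ} {F : Fin k → QueryScheme n α Ω} (hn : 0 < n) (hp : 0 < p)
    (hp1 : p ≤ 1) (hG : 1 ≤ G) (hr : ∀ j w x, ((F j).queried w x).card ≤ r)
    (hs : 100 * (p * n) ≤ s) (hsize : 80 * (r * (r + 1) * G ^ r) ≤ n * p ^ r)
    {j : Fin k} {x : Fin n → α} (hx : 1 / 2 ≤ (F j).acceptWeight x) :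
    1 - 1 / 3 ≤ sampleMean p fun Q => if (thresholdRule F (fun l : ℕ => G ^ l / n) r p
      (1 / (4 * ((r : ℝ) + 1)))).output s x Q = true then 1 else 0 := by
  have hn' : (0 : ℝ) < n := by exact_mod_cast hn
  have hL : Monotone fun l : ℕ => G ^ l / n := fun a c hac =>
    div_le_div_of_nonneg_right (pow_le_pow_right₀ hG hac) hn'.le
  have hlevel : ∃ l ∈ Finset.range (r + 1), 1 / (2 * ((r : ℝ) + 1)) ≤
      ∑ w ∈ (F j).gapRuns (G ^ l / n) (G ^ (l + 1) / n) x, (F j).weight w := by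
    by_contra hcon
    push Not at hcon
    have h1 := acceptWeight_le_sum_gapRuns hL (hr j) x
    have h2 := Finset.sum_lt_sum_of_nonempty (by simp) hcon
    have h3 : ∑ _l ∈ Finset.range (r + 1), 1 / (2 * ((r : ℝ) + 1)) = 1 / 2 := by
      rw [Finset.sum_const, Finset.card_range, nsmul_eq_mul]
      push_cast
      field_simp
    linarith
  obtain ⟨l, hl, hlw⟩ := hlevel
  have h1 := sampleMean_estimate_lower hn hp hp1 hG (hr j) hsize
    (Nat.lt_succ_iff.1 (Finset.mem_range.1 hl)) hlw
  have h2 := sampleMean_card_gt_le (n := n) hp.le hp1 (s := s) (δ := 1 / 100) (by norm_num)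
    (by linarith)
  have hpt : ∀ Q : Finset (Fin n), (1 : ℝ) -
      ((if (F j).estimate p (G ^ l / n) (G ^ (l + 1) / n) x Q < 1 / (4 * ((r : ℝ) + 1))
        then 1 else 0) + if s < Q.card then 1 else 0) ≤
      if (thresholdRule F (fun l : ℕ => G ^ l / n) r p
        (1 / (4 * ((r : ℝ) + 1)))).output s x Q = true then 1 else 0 := by
    intro Q
    by_cases hQs : s < Q.card
    · rw [if_pos hQs]
      split_ifs <;> norm_num
    · by_cases hest : (F j).estimate p (G ^ l / n) (G ^ (l + 1) / n) x Q <
          1 / (4 * ((r : ℝ) + 1))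
      · rw [if_pos hest]
        split_ifs <;> norm_num
      · have hout := thresholdRule_output_of_le (F := F) (L := fun l : ℕ => G ^ l / n) (p := p)
          (τ := 1 / (4 * ((r : ℝ) + 1))) (x := x) (not_lt.1 hQs) j hl (not_lt.1 hest)
        rw [if_neg hQs, if_neg hest, if_pos hout]
        norm_num
  have h3 := sampleMean_mono hp.le hp1 hpt
  rw [sampleMean_sub, sampleMean_const, sampleMean_add] at h3
  refine le_trans ?_ h3
  linarith

/-- Union bound over the `k * (r + 1)` pairs of a property and a level; overflow rejects and costs
nothing here. -/
lemma thresholdRule_sound [Fintype α] {k s b : ℕ} {ε : ℝ} {F : Fin k → QueryScheme n α Ω}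
    {P : Fin k → Set (Fin n → α)} (hn : 0 < n) (hr0 : 0 < r) (hp : 0 < p) (hp1 : p ≤ 1)
    (hG : 1 ≤ G) (hb : 1 ≤ b) (hα : Fintype.card α ≤ b)
    (hF : ∀ j, ∑ w, (F j).weight w = 1) (hr : ∀ j w x, ((F j).queried w x).card ≤ r)
    (hH : ∀ j w, ((F j).reach w).card ≤ H)
    (hrej : ∀ j x, IsFar (ε / 2) x (P j) → (F j).acceptWeight x ≤ 1 / (16 * ((r : ℝ) + 1)))
    (hfar : 2 * (H : ℝ) ≤ ε * G)
    (hkernel : 16 * (r * (r + 1) * (H * Real.log b)) ≤ Real.log 2 * (p ^ r * G))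
    (hk : k * ((r : ℝ) + 1) *
      Real.exp (-(Real.log 2 * (n * p ^ r) / (16 * r * (r + 1) * G ^ r))) ≤ 1 / 10)
    {x : Fin n → α} (hx : IsFar ε x (⋃ j, P j)) :
    sampleMean p (fun Q => if (thresholdRule F (fun l : ℕ => G ^ l / n) r p
      (1 / (4 * ((r : ℝ) + 1)))).output s x Q = true then 1 else 0) ≤ 1 / 10 := by
  classical
  have hn' : (0 : ℝ) < n := by exact_mod_cast hn
  have hG0 : 0 < G := by linarith
  have h1 := sampleMean_exists_le_sum hp.le hp1 (Finset.univ ×ˢ Finset.range (r + 1))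
    (fun (t : Fin k × ℕ) Q => ∃ y : Fin n → α,
      (∀ i ∉ (F t.1).kernel (G ^ (t.2 + 1) / n), y i = x i) ∧
      1 / (4 * ((r : ℝ) + 1)) ≤ (F t.1).estimate p (G ^ t.2 / n) (G ^ (t.2 + 1) / n) y Q)
    (fun Q => (thresholdRule F (fun l : ℕ => G ^ l / n) r p
      (1 / (4 * ((r : ℝ) + 1)))).output s x Q = true) (fun Q hQ => by
        obtain ⟨j, l, hl, hy⟩ := exists_of_thresholdRule_output hp hQ
        exact ⟨(j, l), Finset.mem_product.2 ⟨Finset.mem_univ _, hl⟩, hy⟩)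
  refine h1.trans (le_trans ?_ hk)
  have h2 : ∀ t ∈ (Finset.univ : Finset (Fin k)) ×ˢ Finset.range (r + 1),
      sampleMean p (fun Q => if ∃ y : Fin n → α,
        (∀ i ∉ (F t.1).kernel (G ^ (t.2 + 1) / n), y i = x i) ∧
        1 / (4 * ((r : ℝ) + 1)) ≤ (F t.1).estimate p (G ^ t.2 / n) (G ^ (t.2 + 1) / n) y Q
        then 1 else 0) ≤
      Real.exp (-(Real.log 2 * (n * p ^ r) / (16 * r * (r + 1) * G ^ r))) := by
    rintro ⟨j, l⟩ ht
    have hl : l ≤ r := Nat.lt_succ_iff.1 (Finset.mem_range.1 (Finset.mem_product.1 ht).2)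
    refine sampleMean_exists_agree_le hn hr0 hp hp1 hG (hF j) (hr j) (hH j) hb hα hkernel hl
      (fun y hy => hrej j y ?_) _ fun Q hQ => hQ
    refine isFar_of_agree (fun z hz => hx z (Set.mem_iUnion.2 ⟨j, hz⟩)) hy ?_ hn
    have h3 := card_kernel_mul_le (hi := G ^ (l + 1) / n) (hF j) (hH j)
    have h4 : G ≤ G ^ (l + 1) := le_self_pow₀ hG (by omega)
    rw [mul_div_assoc', div_le_iff₀ hn'] at h3
    have h5 := mul_le_mul_of_nonneg_left h4
      (Nat.cast_nonneg (α := ℝ) ((F j).kernel (G ^ (l + 1) / n)).card)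
    have h6 : (((F j).kernel (G ^ (l + 1) / n)).card : ℝ) * G ≤ ε / 2 * n * G := by nlinarith
    exact le_of_mul_le_mul_right h6 hG0
  refine (Finset.sum_le_sum h2).trans (le_of_eq ?_)
  rw [Finset.sum_const, Finset.card_product, Finset.card_univ, Fintype.card_fin,
    Finset.card_range, nsmul_eq_mul]
  push_cast
  rfl

/-- A union of properties that are decided by adaptive schemes with small error has a
sample-based tester. -/
theorem isSampleTestable_iUnion [Fintype α] {k s b : ℕ} {ε : ℝ} (F : Fin k → QueryScheme n α Ω)
    (P : Fin k → Set (Fin n → α)) (hn : 0 < n) (hr0 : 0 < r) (hp : 0 < p) (hp1 : p ≤ 1)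
    (hG : 1 ≤ G) (hb : 1 ≤ b) (hα : Fintype.card α ≤ b)
    (hF : ∀ j, ∑ w, (F j).weight w = 1) (hr : ∀ j w x, ((F j).queried w x).card ≤ r)
    (hH : ∀ j w, ((F j).reach w).card ≤ H)
    (hacc : ∀ j, ∀ x ∈ P j, 1 / 2 ≤ (F j).acceptWeight x)
    (hrej : ∀ j x, IsFar (ε / 2) x (P j) → (F j).acceptWeight x ≤ 1 / (16 * ((r : ℝ) + 1)))
    (hs : 100 * (p * n) ≤ s) (hfar : 2 * (H : ℝ) ≤ ε * G)
    (hkernel : 16 * (r * (r + 1) * (H * Real.log b)) ≤ Real.log 2 * (p ^ r * G))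
    (hk : k * ((r : ℝ) + 1) *
      Real.exp (-(Real.log 2 * (n * p ^ r) / (16 * r * (r + 1) * G ^ r))) ≤ 1 / 10)
    (hsize : 80 * (r * (r + 1) * G ^ r) ≤ n * p ^ r) :
    IsSampleTestable ε s (⋃ j, P j) := by
  have hpn : 0 ≤ p * n := by positivity
  let R := thresholdRule F (fun l : ℕ => G ^ l / n) r p (1 / (4 * ((r : ℝ) + 1)))
  let N : SampleAlgorithm n α s := ⟨p, hp.le, hp1, by linarith, PMF.pure R⟩
  refine ⟨N, fun x hx => ?_, fun x hx => ?_⟩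
  · obtain ⟨j, hj⟩ := Set.mem_iUnion.1 hx
    rw [N.prOutput_of_pure R rfl]
    exact thresholdRule_complete hn hp hp1 hG hr hs hsize (hacc j x hj)
  · rw [N.prOutput_of_pure R rfl]
    have h1 := thresholdRule_sound (s := s) hn hr0 hp hp1 hG hb hα hF hr hH hrej hfar hkernel
      hk hx
    have h2 : ∀ Q : Finset (Fin n), (if R.output s x Q = false then (1 : ℝ) else 0) =
        1 - if R.output s x Q = true then 1 else 0 := by
      intro Q
      cases R.output s x Q <;> norm_num
    simp only [h2]
    rw [sampleMean_sub, sampleMean_const]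
    have h3 : sampleMean N.p (fun Q => if R.output s x Q = true then (1 : ℝ) else 0) ≤ 1 / 10 :=
      h1
    linarith

end QueryScheme

/-- Sampling with `p = 1` reads everything; this serves the finitely many small `n`. -/
lemma isSampleTestable_self {n : ℕ} {α : Type*} {ε : ℝ} (hε : 0 < ε) (P : Set (Fin n → α)) :
    IsSampleTestable ε n P := by
  classical
  let R : SampleRule n α :=
    ⟨fun Q a => decide (∃ x ∈ P, ∀ i : Q, x i = a i), fun _ => false⟩
  let N : SampleAlgorithm n α n := ⟨1, zero_le_one, le_rfl, by simp, PMF.pure R⟩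
  have hN : ∀ x b, N.prOutput x b = if decide (x ∈ P) = b then 1 else 0 := by
    intro x b
    rw [N.prOutput_of_pure R rfl, sampleMean, Finset.sum_eq_single Finset.univ]
    · have : R.output n x Finset.univ = decide (x ∈ P) := by
        rw [SampleRule.output, if_pos (by simp)]
        refine decide_eq_decide.2 ⟨?_, fun h => ⟨x, h, fun _ => rfl⟩⟩
        rintro ⟨y, hy, hxy⟩
        rwa [← show y = x from funext fun i => hxy ⟨i, Finset.mem_univ i⟩]
      rw [this]
      simp [N]
    · intro Q _ hQ
      have : n - Q.card ≠ 0 := by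
        have := Finset.card_lt_univ_of_notMem (s := Q)
          (Classical.choose_spec (by simpa [Finset.eq_univ_iff_forall] using hQ : ∃ i, i ∉ Q))
        rw [Fintype.card_fin] at this
        omega
      simp [N, this]
    · simp
  refine ⟨N, fun x hx => ?_, fun x hx => ?_⟩
  · rw [hN, if_pos (by simpa using hx)]
    norm_num
  · rw [hN, if_pos]
    · norm_num
    · by_contra hcon
      have hxP : x ∈ P := by simpa using hcon
      have := hx x hxP
      simp [relDist] at this
      linarith

/-! ### Number of repetitions. -/

/-- Half of the number of repetitions that reduce the error of an algorithm with `q` queries below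
the inverse of the total number of queries. -/
def halfRuns (q : ℕ) : ℕ := 80 * Nat.clog 2 (q + 1)

/-- The number of queries of `2 * halfRuns q` repetitions. -/
def totalQueries (q : ℕ) : ℕ := 2 * halfRuns q * q

lemma halfRuns_pos {q : ℕ} (hq : 1 ≤ q) : 0 < halfRuns q :=
  Nat.mul_pos (by norm_num) (Nat.clog_pos one_lt_two (by omega))

lemma totalQueries_pos {q : ℕ} (hq : 1 ≤ q) : 0 < totalQueries q :=
  Nat.mul_pos (Nat.mul_pos two_pos (halfRuns_pos hq)) hq

lemma majority_error_le {q : ℕ} (hq : 1 ≤ q) :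
    (8 / 9 : ℝ) ^ halfRuns q ≤ 1 / (16 * ((totalQueries q : ℝ) + 1)) := by
  set l := Nat.clog 2 (q + 1) with hl
  have hl1 : 1 ≤ l := Nat.clog_pos one_lt_two (by omega)
  have h1 : q + 1 ≤ 2 ^ l := Nat.le_pow_clog one_lt_two _
  have h2 : l ≤ 2 ^ l := Nat.lt_two_pow_self.le
  have h3 : 16 * (totalQueries q + 1) ≤ 10240 ^ l := by
    calc 16 * (totalQueries q + 1) = 16 * (160 * l * q + 1) := by
          rw [totalQueries, halfRuns]
          ring
      _ ≤ 2560 * (l * (q + 1)) := by nlinarith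
      _ ≤ 2560 * (2 ^ l * 2 ^ l) := Nat.mul_le_mul_left _ (Nat.mul_le_mul h2 h1)
      _ ≤ 2560 ^ l * (2 ^ l * 2 ^ l) :=
          Nat.mul_le_mul_right _ (Nat.le_self_pow (by omega) _)
      _ = 10240 ^ l := by
          rw [← mul_pow, ← mul_pow]
          norm_num
  have h4 : (16 : ℝ) * (totalQueries q + 1) ≤ 10240 ^ l := by exact_mod_cast h3
  -- The factor `80` in `halfRuns` is used here: `(8 / 9) ^ 80 ≤ 1 / 10240`.
  have h5 : (8 / 9 : ℝ) ^ halfRuns q ≤ 1 / 10240 ^ l := by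
    rw [halfRuns, pow_mul, ← one_div_pow]
    exact pow_le_pow_left₀ (by positivity) (by norm_num) _
  exact h5.trans (one_div_le_one_div_of_le (by positivity) h4)

lemma totalQueries_le {q : ℕ} (hq : 1 ≤ q) :
    (totalQueries q : ℝ) ≤ 480 * (q * Real.log (q + 1)) := by
  set l := Nat.clog 2 (q + 1) with hl
  have hl1 : 1 ≤ l := Nat.clog_pos one_lt_two (by omega)
  have h1 : 2 ^ (l - 1) < q + 1 := Nat.pow_pred_clog_lt_self one_lt_two (by omega)
  have h2 : ((l : ℝ) - 1) * Real.log 2 ≤ Real.log (q + 1) := by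
    have h3 : ((2 : ℝ) ^ (l - 1)) ≤ q + 1 := by exact_mod_cast h1.le
    have h4 := Real.log_le_log (by positivity) h3
    rw [Real.log_pow] at h4
    push_cast [Nat.cast_sub hl1] at h4
    exact h4
  have h3 : Real.log 2 ≤ Real.log (q + 1) := by
    refine Real.log_le_log two_pos ?_
    have : (1 : ℝ) ≤ q := by exact_mod_cast hq
    linarith
  have h4 := Real.log_two_gt_d9
  have h5 : (l : ℝ) ≤ 3 * Real.log (q + 1) := by nlinarith
  have h6 : (totalQueries q : ℝ) = 160 * l * q := by
    rw [totalQueries, halfRuns]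
    push_cast
    ring
  rw [h6]
  have : (0 : ℝ) ≤ q := Nat.cast_nonneg q
  nlinarith

/-- Testers for properties give a sample-based tester for their union. -/
lemma isSampleTestable_iUnion_of_isTestable {n : ℕ} {α : Type*} [Fintype α] {k s b q : ℕ}
    {ε p G : ℝ} (P : Fin k → Set (Fin n → α)) (hP : ∀ j, IsTestable (ε / 2) q (P j))
    (hn : 0 < n) (hq : 1 ≤ q) (hp : 0 < p) (hp1 : p ≤ 1) (hG : 1 ≤ G) (hb : 1 ≤ b)
    (hα : Fintype.card α ≤ b) {r : ℕ} (hr : r = totalQueries q)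
    (hs : 100 * (p * n) ≤ s) (hfar : 2 * ((r : ℝ) * b ^ q) ≤ ε * G)
    (hkernel : 16 * (r * (r + 1) * (r * b ^ q * Real.log b)) ≤ Real.log 2 * (p ^ r * G))
    (hk : k * ((r : ℝ) + 1) *
      Real.exp (-(Real.log 2 * (n * p ^ r) / (16 * r * (r + 1) * G ^ r))) ≤ 1 / 10)
    (hsize : 80 * (r * (r + 1) * G ^ r) ≤ n * p ^ r) :
    IsSampleTestable ε s (⋃ j, P j) := by
  choose T hT using hP
  let : Fintype (DecisionTree n α q) := Fintype.ofFinite _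
  have herr := majority_error_le hq
  rw [← hr] at herr
  have hr0 : 0 < r := hr ▸ totalQueries_pos hq
  refine QueryScheme.isSampleTestable_iUnion (r := r) (H := r * b ^ q)
    (fun j => QueryScheme.majority (T j) (2 * halfRuns q)) P hn hr0 hp hp1 hG hb hα
    (fun j => QueryScheme.sum_weight_majority (T j) _)
    (fun j w x => hr ▸ QueryScheme.card_queried_majority_le (T j) _ w x)
    (fun j w => hr ▸ QueryScheme.card_reach_majority_le (T j) hb hα _ w)
    (fun j x hx => ?_)
    (fun j x hx => (QueryScheme.acceptWeight_majority_le (T j) ((hT j).2 x hx) _).trans herr)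
    hs (by exact_mod_cast hfar) (by exact_mod_cast hkernel) hk hsize
  refine le_trans ?_ (QueryScheme.le_acceptWeight_majority (T j) ((hT j).1 x hx) _)
  have h1 : 1 / (16 * ((r : ℝ) + 1)) ≤ 1 / 16 :=
    one_div_le_one_div_of_le (by norm_num) (by nlinarith [Nat.cast_nonneg (α := ℝ) r])
  linarith

/-! ### Choice of parameters; `E` plays the role of `log n`. -/

section Parameters

variable {E r M : ℝ}

/-- The exponent is at least `10 r`, so the cubic Taylor term suffices. -/
lemma mul_cube_le_exp (hr : 1 ≤ r) (hM : 8000 ≤ M) (hE : M * r ^ 2 ≤ E) :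
    64 * r ^ 3 ≤ Real.exp (E / (8 * r)) := by
  have h1 : 10 * r ≤ E / (8 * r) := by
    rw [le_div_iff₀ (by positivity)]
    nlinarith
  have h2 := Real.pow_div_factorial_le_exp (E / (8 * r)) (by linarith) 3
  have h3 := pow_le_pow_left₀ (by positivity) h1 3
  have h4 : ((Nat.factorial 3 : ℕ) : ℝ) = 6 := by norm_num [Nat.factorial]
  rw [h4] at h2
  have : 0 < r ^ 3 := by positivity
  nlinarith

lemma sq_mul_le_exp (hr : 1 ≤ r) (hM : 8000 ≤ M) (hE : M * r ^ 2 ≤ E) :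
    80 * (r * (r + 1)) ≤ Real.exp (E / 4) := by
  have hE0 : 8000 ≤ E := by nlinarith
  have h1 := Real.add_one_le_exp (E / 4)
  have h2 : 8000 * r ^ 2 ≤ E := by nlinarith
  nlinarith

lemma log_bound_le_exp (hr : 1 ≤ r) (hM : 8000 ≤ M) (hE : M * r ^ 2 ≤ E) :
    Real.exp (E / 8) + r + 9 ≤ Real.log 2 * Real.exp (E / 4) / (16 * r * (r + 1)) := by
  have hE0 : 8000 ≤ E := by nlinarith
  have h1 := Real.add_one_le_exp (E / 8)
  have h2 : 8000 * r ^ 2 ≤ E := by nlinarith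
  have h3 : Real.exp (E / 4) = Real.exp (E / 8) * Real.exp (E / 8) := by
    rw [← Real.exp_add]
    congr 1
    ring
  have h4 := Real.log_two_gt_d9
  rw [le_div_iff₀ (by positivity), h3]
  set z := Real.exp (E / 8)
  have h5 : z + r + 9 ≤ 18 * z := by nlinarith
  have h6 : 16 * r * (r + 1) ≤ E / 250 := by nlinarith
  calc (z + r + 9) * (16 * r * (r + 1)) ≤ (18 * z) * (E / 250) :=
        mul_le_mul h5 h6 (by positivity) (by positivity)
    _ ≤ (18 * z) * (8 * z / 250) := by
        refine mul_le_mul_of_nonneg_left ?_ (by positivity)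
        linarith
    _ ≤ Real.log 2 * (z * z) := by nlinarith [mul_self_nonneg z]

end Parameters

/-- The sampling probability used for algorithms with `r` queries. -/
noncomputable def sampleProb (n r : ℕ) : ℝ := Real.exp (-(Real.log n / (4 * (r : ℝ) ^ 2)))

lemma pow_mul_log_le {b : ℝ} {q : ℕ} (hb : 1 ≤ b) (hq : 1 ≤ q) :
    b ^ q * Real.log b ≤ b ^ (2 * q) := by
  have h1 : Real.log b ≤ b ^ q :=
    ((Real.log_le_sub_one_of_pos (by linarith)).trans (by linarith)).trans
      (le_self_pow₀ hb (by omega))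
  calc b ^ q * Real.log b ≤ b ^ q * b ^ q := mul_le_mul_of_nonneg_left h1 (by positivity)
    _ = b ^ (2 * q) := by ring

/-- Here `u = q log (q + 1)`. The cubic exponent arises from `q * r`, with `r = O(u)` and `q = O(u ^
2)`; the constant `20000` covers `16 * 480 / 0.48`. -/
lemma alphabet_pow_le {n q : ℕ} {b r u : ℝ} (hn : 0 < n) (hq : (1 : ℝ) ≤ q) (hu : 0 < u)
    (hqu : 0.48 * q ≤ u ^ 2) (hr : 0 < r) (hru : r ≤ 480 * u) (hb : 1 ≤ b)
    (hbn : b ≤ (n : ℝ) ^ (1 / (20000 * u ^ 3))) :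
    b ^ (2 * q) ≤ Real.exp (Real.log n / (8 * r)) := by
  have hn' : (0 : ℝ) < n := by exact_mod_cast hn
  have hE : 0 ≤ Real.log n := Real.log_nonneg (by exact_mod_cast hn)
  have hlog : Real.log b ≤ Real.log n / (20000 * u ^ 3) := by
    have h2 := Real.log_le_log (by linarith) hbn
    rwa [Real.log_rpow hn', one_div_mul_eq_div] at h2
  have h1 : 2 * (q : ℝ) * (8 * r) ≤ 20000 * u ^ 3 := by
    calc 2 * (q : ℝ) * (8 * r) ≤ 2 * q * (8 * (480 * u)) := by gcongr
      _ = (7680 * q) * u := by ring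
      _ ≤ (20000 * u ^ 2) * u := mul_le_mul_of_nonneg_right (by linarith) hu.le
      _ = 20000 * u ^ 3 := by ring
  rw [← Real.log_le_iff_le_exp (by positivity), Real.log_pow]
  push_cast
  calc 2 * (q : ℝ) * Real.log b ≤ 2 * q * (Real.log n / (20000 * u ^ 3)) :=
        mul_le_mul_of_nonneg_left hlog (by positivity)
    _ = 2 * q * Real.log n / (20000 * u ^ 3) := by ring
    _ ≤ Real.log n / (8 * r) := by
        rw [div_le_div_iff₀ (by positivity) (by positivity)]
        calc 2 * (q : ℝ) * Real.log n * (8 * r) = Real.log n * (2 * q * (8 * r)) := by ring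
          _ ≤ Real.log n * (20000 * u ^ 3) := mul_le_mul_of_nonneg_left h1 hE

/-- With these `p` and `G`, `p ^ r * G = n ^ (1 / (4 r))` splits into two factors `n ^ (1 / (8 r))`,
one for the polynomial in `r` and one for the alphabet. Also `G ^ r = n ^ (1 / 2)` and `n * p ^ r ≥
n ^ (3 / 4)`, so the exponent has order `n ^ (1 / 4) / r ^ 2` and dominates `log k ≤ n ^ (1 / 8)`.
-/
lemma isSampleTestable_of_large {n : ℕ} {α : Type*} [Fintype α] {k s q : ℕ} {ε M : ℝ}
    (hε : 0 < ε) (P : Fin k → Set (Fin n → α)) (hP : ∀ j, IsTestable (ε / 2) q (P j))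
    (hn : 0 < n) (hq : 1 ≤ q) (hM : 8000 ≤ M) (hMε : 16 / ε ≤ M)
    (hE : M * (totalQueries q : ℝ) ^ 2 ≤ Real.log n)
    (hα : (Fintype.card α : ℝ) ≤
      (n : ℝ) ^ (1 / (20000 * ((q : ℝ) ^ 3 * Real.log (q + 1) ^ 3))))
    (hk : (k : ℝ) ≤
      Real.exp ((n : ℝ) ^ (1 / (20000 * ((q : ℝ) ^ 2 * Real.log (q + 1) ^ 2)))))
    (hs : 100 * (sampleProb n (totalQueries q) * n) ≤ s) :
    IsSampleTestable ε s (⋃ j, P j) := by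
  set r := totalQueries q with hr
  set E := Real.log n with hEdef
  have hn' : (0 : ℝ) < n := by exact_mod_cast hn
  have hr1 : (1 : ℝ) ≤ r := by exact_mod_cast totalQueries_pos hq
  have hrpos : (0 : ℝ) < r := by linarith
  have hq1 : (1 : ℝ) ≤ q := by exact_mod_cast hq
  have hE0 : 8000 ≤ E := by nlinarith
  have hnE : (n : ℝ) = Real.exp E := (Real.exp_log hn').symm
  have hl2 := Real.log_two_gt_d9
  have hlq : Real.log 2 ≤ Real.log (q + 1) := Real.log_le_log two_pos (by linarith)
  set u := (q : ℝ) * Real.log (q + 1) with hu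
  have hru : (r : ℝ) ≤ 480 * u := totalQueries_le hq
  have hlq0 : 0 < Real.log ((q : ℝ) + 1) := by linarith
  have hu0 : 0 < u := by positivity
  have hqu : 0.48 * q ≤ u ^ 2 := by
    have h1 : 0.48 ≤ Real.log ((q : ℝ) + 1) ^ 2 := by nlinarith
    have h2 : (q : ℝ) ≤ q ^ 2 := by nlinarith
    rw [hu, mul_pow]
    nlinarith
  have hu3 : (q : ℝ) ^ 3 * Real.log (q + 1) ^ 3 = u ^ 3 := by rw [hu, mul_pow]
  have hu2 : (q : ℝ) ^ 2 * Real.log (q + 1) ^ 2 = u ^ 2 := by rw [hu, mul_pow]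
  rw [hu3] at hα
  rw [hu2] at hk
  -- The maximum covers an empty alphabet.
  set b := max 1 (Fintype.card α) with hb
  have hb1 : 1 ≤ b := le_max_left _ _
  have hb1' : (1 : ℝ) ≤ b := by exact_mod_cast hb1
  have hbpow : (b : ℝ) ^ (2 * q) ≤ Real.exp (E / (8 * r)) :=
    alphabet_pow_le hn hq1 hu0 hqu hrpos hru hb1' (by
      rw [hb]
      push_cast
      exact max_le (Real.one_le_rpow (by exact_mod_cast hn) (by positivity)) hα)
  have hbq : (b : ℝ) ^ q ≤ (b : ℝ) ^ (2 * q) := pow_le_pow_right₀ hb1' (by omega)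
  have hblog := pow_mul_log_le hb1' hq
  have hp1 : sampleProb n r ≤ 1 := by
    rw [sampleProb, Real.exp_le_one_iff, neg_nonpos]
    positivity
  have hpr : sampleProb n r ^ r = Real.exp (-(E / (4 * r))) := by
    rw [sampleProb, ← Real.exp_nat_mul]
    congr 1
    field_simp
    rfl
  have hGr : Real.exp (E / (2 * r)) ^ r = Real.exp (E / 2) := by
    rw [← Real.exp_nat_mul]
    congr 1
    field_simp
  have hprG : sampleProb n r ^ r * Real.exp (E / (2 * r)) =
      Real.exp (E / (8 * r)) * Real.exp (E / (8 * r)) := by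
    rw [hpr, ← Real.exp_add, ← Real.exp_add]
    congr 1
    field_simp
    norm_num
  have hnpr : Real.exp (E / 4) * Real.exp (E / 2) ≤ n * sampleProb n r ^ r := by
    rw [hpr, hnE, ← Real.exp_add, ← Real.exp_add]
    refine Real.exp_le_exp.2 ?_
    have : E / (4 * r) ≤ E / 4 := div_le_div_of_nonneg_left (by linarith) (by norm_num) (by linarith)
    linarith
  have hcube := mul_cube_le_exp hr1 hM hE
  refine isSampleTestable_iUnion_of_isTestable P hP hn hq (b := b) (r := r)
    (p := sampleProb n r) (G := Real.exp (E / (2 * r))) (Real.exp_pos _) hp1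
    (Real.one_le_exp (by positivity)) hb1 (le_max_right _ _) hr hs ?_ ?_ ?_ ?_
  · have h1 : Real.exp (E / (8 * r)) * Real.exp (E / (8 * r)) ≤ Real.exp (E / (2 * r)) := by
      rw [← Real.exp_add]
      refine Real.exp_le_exp.2 ?_
      have e : E / (8 * r) + E / (8 * r) = E / (4 * r) := by
        field_simp
        norm_num
      rw [e]
      exact div_le_div_of_nonneg_left (by linarith) (by positivity) (by linarith)
    have h2 : 2 * (r : ℝ) ≤ ε * Real.exp (E / (8 * r)) := by
      have h3 := Real.add_one_le_exp (E / (8 * r))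
      have h4 : 2 * r / ε ≤ E / (8 * r) := by
        rw [le_div_iff₀ (by positivity)]
        calc 2 * r / ε * (8 * r) = 16 / ε * r ^ 2 := by ring
          _ ≤ M * r ^ 2 := mul_le_mul_of_nonneg_right hMε (by positivity)
          _ ≤ E := hE
      rw [← div_le_iff₀' hε]
      linarith
    calc 2 * ((r : ℝ) * b ^ q) = 2 * r * b ^ q := by ring
      _ ≤ ε * Real.exp (E / (8 * r)) * Real.exp (E / (8 * r)) :=
          mul_le_mul h2 (hbq.trans hbpow) (by positivity) (by positivity)
      _ = ε * (Real.exp (E / (8 * r)) * Real.exp (E / (8 * r))) := by ring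
      _ ≤ ε * Real.exp (E / (2 * r)) := mul_le_mul_of_nonneg_left h1 hε.le
  · rw [hprG]
    have h1 : 16 * ((r : ℝ) * (r + 1) * r) ≤ 32 * r ^ 3 := by
      have : (r : ℝ) ^ 2 ≤ r ^ 3 := pow_le_pow_right₀ hr1 (by norm_num)
      linarith
    have h2 : 32 * (r : ℝ) ^ 3 ≤ Real.log 2 * Real.exp (E / (8 * r)) := by
      have := mul_le_mul_of_nonneg_right (show 1 / 2 ≤ Real.log 2 by linarith)
        (Real.exp_pos (E / (8 * r))).le
      linarith
    calc 16 * ((r : ℝ) * (r + 1) * (r * b ^ q * Real.log b))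
        = 16 * ((r : ℝ) * (r + 1) * r) * (b ^ q * Real.log b) := by ring
      _ ≤ Real.log 2 * Real.exp (E / (8 * r)) * Real.exp (E / (8 * r)) := by
          refine mul_le_mul (h1.trans h2) (hblog.trans hbpow) ?_ (by positivity)
          have := Real.log_nonneg hb1'
          positivity
      _ = _ := by ring
  · rw [hGr]
    have h1 : Real.log 2 * Real.exp (E / 4) / (16 * r * (r + 1)) ≤
        Real.log 2 * (n * sampleProb n r ^ r) / (16 * r * (r + 1) * Real.exp (E / 2)) := by
      rw [div_le_div_iff₀ (by positivity) (by positivity)]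
      calc Real.log 2 * Real.exp (E / 4) * (16 * r * (r + 1) * Real.exp (E / 2))
          = Real.log 2 * (16 * r * (r + 1)) * (Real.exp (E / 4) * Real.exp (E / 2)) := by ring
        _ ≤ Real.log 2 * (16 * r * (r + 1)) * (n * sampleProb n r ^ r) :=
            mul_le_mul_of_nonneg_left hnpr (by positivity)
        _ = _ := by ring
    have h2 := (log_bound_le_exp hr1 hM hE).trans h1
    have h3 : (k : ℝ) ≤ Real.exp (Real.exp (E / 8)) := by
      refine hk.trans (Real.exp_le_exp.2 ?_)
      rw [Real.rpow_def_of_pos hn']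
      refine Real.exp_le_exp.2 ?_
      rw [← hEdef, mul_one_div]
      refine div_le_div_of_nonneg_left (by linarith) (by norm_num) ?_
      linarith
    have h4 : (r : ℝ) + 1 ≤ Real.exp r := Real.add_one_le_exp _
    have h5 : (10 : ℝ) ≤ Real.exp 9 := by linarith [Real.add_one_le_exp (9 : ℝ)]
    set X := Real.log 2 * (n * sampleProb n r ^ r) / (16 * r * (r + 1) * Real.exp (E / 2))
    have h6 : (k : ℝ) * (r + 1) * 10 ≤ Real.exp X := by
      calc (k : ℝ) * (r + 1) * 10 ≤ Real.exp (Real.exp (E / 8)) * Real.exp r * Real.exp 9 := by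
            gcongr
        _ = Real.exp (Real.exp (E / 8) + r + 9) := by rw [Real.exp_add, Real.exp_add]
        _ ≤ Real.exp X := Real.exp_le_exp.2 h2
    rw [Real.exp_neg, ← div_eq_mul_inv, div_le_iff₀ (Real.exp_pos _)]
    linarith
  · rw [hGr]
    refine le_trans ?_ hnpr
    rw [← mul_assoc]
    exact mul_le_mul_of_nonneg_right (sq_mul_le_exp hr1 hM hE) (Real.exp_pos _).le

lemma eventually_mul_totalQueries_sq_le {q : ℕ → ℕ} (hq : ∀ n, 1 ≤ q n)
    (h : (fun n : ℕ => (q n : ℝ) ^ 2 * Real.log (q n + 1) ^ 2) =o[atTop]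
      fun n : ℕ => Real.log n) {M : ℝ} (hM : 0 < M) :
    ∀ᶠ n : ℕ in atTop, M * (totalQueries (q n) : ℝ) ^ 2 ≤ Real.log n := by
  have h1 := (isLittleO_iff.1 h) (show (0 : ℝ) < 1 / (M * 480 ^ 2) by positivity)
  filter_upwards [h1, eventually_ge_atTop 1] with n hn hn1
  have hlog : 0 ≤ Real.log n := Real.log_nonneg (by exact_mod_cast hn1)
  rw [Real.norm_of_nonneg (by positivity), Real.norm_of_nonneg hlog, one_div_mul_eq_div,
    le_div_iff₀ (by positivity)] at hn
  have h2 := pow_le_pow_left₀ (Nat.cast_nonneg _) (totalQueries_le (hq n)) 2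
  calc M * (totalQueries (q n) : ℝ) ^ 2 ≤ M * (480 * (q n * Real.log (q n + 1))) ^ 2 :=
        mul_le_mul_of_nonneg_left h2 hM.le
    _ = q n ^ 2 * Real.log (q n + 1) ^ 2 * (M * 480 ^ 2) := by ring
    _ ≤ Real.log n := hn

lemma sampleSize_isLittleO {q : ℕ → ℕ} (hq : ∀ n, 1 ≤ q n)
    (h : (fun n : ℕ => (q n : ℝ) ^ 2 * Real.log (q n + 1) ^ 2) =o[atTop]
      fun n : ℕ => Real.log n) :
    (fun n : ℕ => (⌈100 * (sampleProb n (totalQueries (q n)) * n)⌉₊ : ℝ)) =o[atTop]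
      fun n : ℕ => (n : ℝ) := by
  rw [isLittleO_iff]
  intro c hc
  -- Chosen so that `100 * p ≤ c / 2`; the other `c / 2` absorbs the rounding by the ceiling.
  set D := max 1 (Real.log (200 / c)) with hD
  have hD0 : 0 < D := lt_of_lt_of_le one_pos (le_max_left _ _)
  filter_upwards [eventually_mul_totalQueries_sq_le hq h (M := 4 * D) (by positivity),
    eventually_ge_atTop ⌈2 / c⌉₊] with n h1 h2
  have hn : 2 / c ≤ n := (Nat.le_ceil _).trans (by exact_mod_cast h2)
  rw [div_le_iff₀ hc] at hn
  have hr : (0 : ℝ) < totalQueries (q n) := by exact_mod_cast totalQueries_pos (hq n)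
  have hp : sampleProb n (totalQueries (q n)) ≤ c / 200 := by
    have h3 : D ≤ Real.log n / (4 * (totalQueries (q n) : ℝ) ^ 2) := by
      rw [le_div_iff₀ (by positivity)]
      linarith
    have h4 : Real.log (200 / c) ≤ Real.log n / (4 * (totalQueries (q n) : ℝ) ^ 2) :=
      (le_max_right _ _).trans h3
    rw [sampleProb, ← Real.le_log_iff_exp_le (by positivity)]
    rw [show c / 200 = (200 / c)⁻¹ by rw [inv_div], Real.log_inv]
    linarith
  rw [Real.norm_of_nonneg (Nat.cast_nonneg _), Real.norm_of_nonneg (Nat.cast_nonneg _)]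
  have h5 : 0 ≤ 100 * (sampleProb n (totalQueries (q n)) * n) := by
    have := Real.exp_pos (-(Real.log n / (4 * (totalQueries (q n) : ℝ) ^ 2)))
    unfold sampleProb
    positivity
  have h6 := Nat.ceil_lt_add_one h5
  have h7 : sampleProb n (totalQueries (q n)) * n ≤ c / 200 * n :=
    mul_le_mul_of_nonneg_right hp (Nat.cast_nonneg _)
  linarith

theorem corollary7p2 :
    ∃ C : ℝ, 0 < C ∧
      ∀ (ε : ℝ), 0 < ε →
      ∀ (q k : ℕ → ℕ) (A : ℕ → Type*) [∀ n, Fintype (A n)],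
        (∀ n, 1 ≤ q n) →
        ((fun n : ℕ => (q n : ℝ) ^ 2 * Real.log (q n + 1) ^ 2)
          =o[atTop] fun n : ℕ => Real.log n) →
        (∀ᶠ n : ℕ in atTop, (Fintype.card (A n) : ℝ) ≤
          (n : ℝ) ^ (1 / (C * ((q n : ℝ) ^ 3 * Real.log (q n + 1) ^ 3)))) →
        (∀ᶠ n : ℕ in atTop, (k n : ℝ) ≤
          Real.exp ((n : ℝ) ^ (1 / (C * ((q n : ℝ) ^ 2 * Real.log (q n + 1) ^ 2))))) →
        ∃ s : ℕ → ℕ, ((fun n : ℕ => (s n : ℝ)) =o[atTop] fun n : ℕ => (n : ℝ)) ∧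
          ∀ (n : ℕ) (P : Set (Fin n → A n)) (Ps : Fin (k n) → Set (Fin n → A n)),
            P = ⋃ i, Ps i →
            (∀ i, IsTestable (ε / 2) (q n) (Ps i)) →
            IsSampleTestable ε (s n) P := by
  classical
  refine ⟨20000, by norm_num, ?_⟩
  intro ε hε q k A _ hq hqo hA hk
  -- `8000` serves the numerical inequalities, `16 / ε` the smallness of the kernel.
  set M := max 8000 (16 / ε) with hM
  have hM0 : 0 < M := lt_of_lt_of_le (by norm_num) (le_max_left _ _)
  obtain ⟨N, hN⟩ := eventually_atTop.1
    (((eventually_mul_totalQueries_sq_le hq hqo hM0).and (hA.and hk)).and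
      (eventually_ge_atTop 1))
  refine ⟨fun n => if N ≤ n then ⌈100 * (sampleProb n (totalQueries (q n)) * n)⌉₊ else n,
    ?_, ?_⟩
  · refine (sampleSize_isLittleO hq hqo).congr' ?_ EventuallyEq.rfl
    filter_upwards [eventually_ge_atTop N] with n hn
    simp only [if_pos hn]
  · rintro n P Ps rfl hPs
    by_cases hn : N ≤ n
    · simp only [if_pos hn]
      obtain ⟨⟨h1, h2, h3⟩, h4⟩ := hN n hn
      exact isSampleTestable_of_large hε Ps hPs h4 (hq n) (le_max_left _ _) (le_max_right _ _)
        h1 h2 h3 (Nat.le_ceil _)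
    · simp only [if_neg hn]
      exact isSampleTestable_self hε _
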